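/- Let $\mathbb{T}^\infty$ be the infinite-dimensional torus with its normalized Haar measure (the product of the normalized Lebesgue measures of the variables $z_1,z_2,\ldots$), let $H^2(\mathbb{D}^\infty)\subset L^2(\mathbb{T}^\infty)$ be the closure of the analytic polynomials, and let $\overline{H^2}(\mathbb{D}^\infty)$ be the space of complex conjugates of its elements. For $\varphi\in L^2(\mathbb{T}^\infty)$ let $H_\varphi$ be the multiplicative Hankel form $H_\varphi(fg)=\langle fg,\varphi\rangle_{L^2(\mathbb{T}^\infty)}$ on $H^2(\mathbb{D}^\infty)\times H^2(\mathbb{D}^\infty)$, realized as the Hankel operator $\mathbf{H}_\varphi\colon H^2(\mathbb{D}^\infty)\to\overline{H^2}(\mathbb{D}^\infty)$ given on polynomials by $\mathbf{H}_\varphi f=\overline{P}(\overline{\varphi}f)$, where $\overline{P}$ is the orthogonal projection of $L^2(\mathbb{T}^\infty)$ onto $\overline{H^2}(\mathbb{D}^\infty)$. For $0<p<\infty$, $H_\varphi$ belongs to the Schatten class $\mathcal{S}_p$ if $\mathbf{H}_\varphi$ is (bounded and) compact and its singular value sequence $\Lambda$ lies in $\ell^p$, and then $\|H_\varphi\|_{\mathcal{S}_p}=\|\Lambda\|_{\ell^p}$.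 Theorem. Let $0<p\le p_0=\left(1-\frac{\log\pi}{\log 4}\right)^{-1}$, let $d$ be a non-negative integer, let $a_1,\ldots,a_d,b_1,\ldots,b_d\in\mathbb{C}$, and put \[\varphi(z)=a_1z_1+\cdots+a_dz_d,\qquad f(z)=b_1z_1+\cdots+b_dz_d.\] Then $H_\varphi\in\mathcal{S}_p$ and \[|\langle f,\varphi\rangle_{L^2(\mathbb{T}^\infty)}|\le\|H_\varphi\|_{\mathcal{S}_p}\,\|f\|_{L^1(\mathbb{T}^\infty)}.\] -/

import Mathlib

open MeasureTheory

noncomputable section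

/-! ### The infinite polytorus -/

/-- The infinite polytorus `𝕋^∞`: a point is the sequence of its angles, an angle `t ∈ ℝ/ℤ` standing
for the point `exp (2πit)` of the unit circle. -/
abbrev Polytorus : Type := ℕ → UnitAddCircle

/-- The Haar probability measure of `𝕋^∞`: the product of the normalized Lebesgue measures of the
individual variables. -/
abbrev polytorusMeasure : Measure Polytorus :=
  Measure.infinitePi fun _ : ℕ => (AddCircle.haarAddCircle : Measure UnitAddCircle)

/-- The coordinate function `z_j` on `𝕋^∞` (variables are numbered from `0`). -/
def coordFun (j : ℕ) : C(Polytorus, ℂ) := (fourier 1).comp (ContinuousMap.eval j)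

/-- An analytic polynomial in the variables `z_0, z_1, z_2, …`, as a function on `𝕋^∞`. -/
def polyFun (P : MvPolynomial ℕ ℂ) : C(Polytorus, ℂ) := MvPolynomial.aeval coordFun P

/-- The space `L²(𝕋^∞)`. -/
abbrev L2Polytorus : Type := Lp ℂ 2 polytorusMeasure

/-- An analytic polynomial as an element of `L²(𝕋^∞)`. -/
def polyL2 (P : MvPolynomial ℕ ℂ) : L2Polytorus :=
  ContinuousMap.toLp 2 polytorusMeasure ℂ (polyFun P)

/-- The complex conjugate of an analytic polynomial as an element of `L²(𝕋^∞)`. -/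
def conjPolyL2 (P : MvPolynomial ℕ ℂ) : L2Polytorus :=
  ContinuousMap.toLp 2 polytorusMeasure ℂ (star (polyFun P))

/-- The Hardy space `H²(𝔻^∞)`, as a subspace of `L²(𝕋^∞)`: the closure of the analytic
polynomials. -/
def hardySpace : Submodule ℂ L2Polytorus :=
  (Submodule.span ℂ (Set.range polyL2)).topologicalClosure

/-- The space of complex conjugates of the elements of `H²(𝔻^∞)`. -/
def antiHardySpace : Submodule ℂ L2Polytorus :=
  (Submodule.span ℂ (Set.range conjPolyL2)).topologicalClosure

instance : CompleteSpace hardySpace :=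
  (Submodule.isClosed_topologicalClosure _).completeSpace_coe

instance : CompleteSpace antiHardySpace :=
  (Submodule.isClosed_topologicalClosure _).completeSpace_coe

/-- An analytic polynomial as an element of `H²(𝔻^∞)`. -/
def polyHardy (P : MvPolynomial ℕ ℂ) : hardySpace :=
  ⟨polyL2 P, Submodule.le_topologicalClosure _ (Submodule.subset_span ⟨P, rfl⟩)⟩

/-! ### Schatten classes -/

section Schatten

variable {E F : Type*} [NormedAddCommGroup E] [InnerProductSpace ℂ E] [CompleteSpace E]
  [NormedAddCommGroup F] [InnerProductSpace ℂ F] [CompleteSpace F]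

/-- The multiplicity of `s > 0` as a singular value of `T`: the dimension of the eigenspace of
`T* T` for the eigenvalue `s ^ 2` (it is `0` if `s` is not a singular value; for compact `T` and
`s > 0` it is always finite). -/
def singularValueMultiplicity (T : E →L[ℂ] F) (s : ℝ) : ℕ :=
  Module.finrank ℂ (Module.End.eigenspace
    ((ContinuousLinearMap.adjoint T ∘L T : E →L[ℂ] E) : E →ₗ[ℂ] E) ((s : ℂ) ^ 2))

/-- `T` belongs to the Schatten class `𝒮_p`: it is compact, and its singular value sequence
(each positive singular value repeated according to its multiplicity) is in `ℓ^p`. -/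
def MemSchatten (p : ℝ) (T : E →L[ℂ] F) : Prop :=
  IsCompactOperator T ∧
    Summable fun s : Set.Ioi (0 : ℝ) => (singularValueMultiplicity T s : ℝ) * (s : ℝ) ^ p

/-- The `𝒮_p`-norm of `T`: the `ℓ^p`-norm of its singular value sequence. -/
def schattenNorm (p : ℝ) (T : E →L[ℂ] F) : ℝ :=
  (∑' s : Set.Ioi (0 : ℝ), (singularValueMultiplicity T s : ℝ) * (s : ℝ) ^ p) ^ (1 / p)

end Schatten

/-! ### Multiplicative Hankel forms -/

/-- The product of the conjugate of `φ ∈ L²(𝕋^∞)` with a polynomial is square integrable. -/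
theorem memLp_conj_mul_poly (φ : L2Polytorus) (P : MvPolynomial ℕ ℂ) :
    MemLp (fun z => star (φ z) * polyFun P z) 2 polytorusMeasure := by
  have h1 : MemLp (fun z => star (φ z)) 2 polytorusMeasure := (Lp.memLp φ).star
  have h2 : MemLp (fun z => polyFun P z) ⊤ polytorusMeasure :=
    memLp_top_of_bound (polyFun P).continuous.aestronglyMeasurable ‖polyFun P‖
      (Filter.Eventually.of_forall (polyFun P).norm_coe_le_norm)
  exact h2.mul h1

/-- The product of the conjugate of `φ ∈ L²(𝕋^∞)` with a polynomial, as an element of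
`L²(𝕋^∞)`. -/
def conjMulPoly (φ : L2Polytorus) (P : MvPolynomial ℕ ℂ) : L2Polytorus :=
  (memLp_conj_mul_poly φ P).toLp

/-- `T` is the (bounded) multiplicative Hankel operator with symbol `φ`: on polynomials `f` it is
given by applying to `conj φ * f` the orthogonal projection of `L²(𝕋^∞)` onto the anti-analytic
space. -/
def IsHankelOperator (φ : L2Polytorus) (T : hardySpace →L[ℂ] antiHardySpace) : Prop :=
  ∀ P : MvPolynomial ℕ ℂ,
    T (polyHardy P) = antiHardySpace.orthogonalProjectionOnto (conjMulPoly φ P)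

/-- The polynomials are dense in the Hardy space. -/
theorem dense_span_polyHardy :
    Dense (Submodule.span ℂ (Set.range polyHardy) : Set hardySpace) := by
  rw [Subtype.dense_iff]
  have h : ((↑) : hardySpace → L2Polytorus) '' (Submodule.span ℂ (Set.range polyHardy)) =
      (Submodule.span ℂ (Set.range polyL2) : Set L2Polytorus) := by
    have := Submodule.map_span hardySpace.subtype (Set.range polyHardy)
    rw [← Set.range_comp] at this
    exact congrArg (fun S : Submodule ℂ L2Polytorus => (S : Set L2Polytorus)) this
  exact fun x hx => (congrArg closure h).symm.subset hx

/-- A symbol determines its bounded Hankel operator. -/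
theorem IsHankelOperator.unique {φ : L2Polytorus} {T T' : hardySpace →L[ℂ] antiHardySpace}
    (h : IsHankelOperator φ T) (h' : IsHankelOperator φ T') : T = T' := by
  refine ContinuousLinearMap.ext_on dense_span_polyHardy ?_
  rintro _ ⟨P, rfl⟩
  rw [h P, h' P]

open Classical in
/-- The multiplicative Hankel operator with symbol `φ` (by convention `0` if it is unbounded). -/
def hankelOperator (φ : L2Polytorus) : hardySpace →L[ℂ] antiHardySpace :=
  if h : ∃ T, IsHankelOperator φ T then h.choose else 0

/-- The operator chosen above is the Hankel operator. -/
theorem IsHankelOperator.eq_hankelOperator {φ : L2Polytorus}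
    {T : hardySpace →L[ℂ] antiHardySpace} (h : IsHankelOperator φ T) : hankelOperator φ = T := by
  have h' : ∃ T, IsHankelOperator φ T := ⟨T, h⟩
  rw [hankelOperator, dif_pos h']
  exact h'.choose_spec.unique h

/-- The Hankel form `H_φ` belongs to the Schatten class `𝒮_p`. -/
def HankelMemSchatten (p : ℝ) (φ : L2Polytorus) : Prop :=
  (∃ T, IsHankelOperator φ T) ∧ MemSchatten p (hankelOperator φ)

/-- The `𝒮_p`-norm of the Hankel form `H_φ`. -/
def hankelSchattenNorm (p : ℝ) (φ : L2Polytorus) : ℝ :=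
  schattenNorm p (hankelOperator φ)

/-! ### Linear polynomials and the critical exponent -/

/-- The homogeneous linear polynomial with coefficients `c_0, …, c_{d-1}`. -/
def linearPoly {d : ℕ} (c : Fin d → ℂ) : MvPolynomial ℕ ℂ :=
  ∑ j : Fin d, MvPolynomial.C (c j) * MvPolynomial.X (j : ℕ)

/-- The critical exponent `p₀ = (1 - log π / log 4)⁻¹`. -/
def criticalExponent : ℝ := (1 - Real.log Real.pi / Real.log 4)⁻¹

end

/-!
For a linear symbol `φ = ∑ a_j z_j` the Hankel operator is `h ↦ ⟪1, h⟫ φ̄ + ⟪φ, h⟫ 1`, because pairing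
with `φ` only sees the linear coefficients of a polynomial and is a derivation at the origin
(`isHankelOperator_linearPoly`). As `1 ⊥ φ`, its nonzero singular values are `‖a‖₂`, `‖a‖₂`
(`schatten_swapOperator`), so that its `𝒮_p`-norm is `2 ^ (1 / p) ‖a‖₂`, and `p ≤ p₀` says exactly
that `2 ^ (1 / p) ≥ 2 / √π`. By the Cauchy-Schwarz inequality the claim follows from the sharp
Khinchine inequality `‖b‖₂ ≤ (2 / √π) E |∑ b_j z_j|` for independent variables `z_j` uniform on the
circle (`khinchine_steinhaus`); the constant is the one of a complex Gaussian variable.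

Its proof follows Haagerup's method. From `r = ∫₀^∞ (1 - J₀(r t)) dt / t²` and the product formula
`E J₀(t |f|) = ∏ J₀(|b_j| t)` one gets `E |f| = ∫₀^∞ (1 - ∏ J₀(|b_j| t)) dt / t²`
(`integral_norm_steinhausSum`). The key estimate is that for every `s ≥ 2`
`∫₀^∞ (1 - |J₀(t)| ^ s) dt / t² ≥ ∫₀^∞ (1 - exp (-s t² / 4)) dt / t² = √(π s) / 2`
(`sqrt_le_integral_one_sub_besselJ0_rpow`). For `s = 2` the left side is `E |z₁ + z₂| = 4 / π`, which
leaves some slack, and the bound `|J₀| ≤ 107/250` on `[46/25, ∞)` together with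
`|J₀(t)| ≤ exp (-t² / 4)` on `[0, 46/25]` transports the inequality from `2` to all larger exponents
(`exp_sub_besselJ0_rpow_ge`).

Normalize `‖b‖₂ = 1` and let `β` be the largest `|b_j|²`.
* If `β ≤ 1/2`, the inequality of arithmetic and geometric means bounds the product of Bessel
  functions by `∑ |b_j|² |J₀(|b_j| t)| ^ (1 / |b_j|²)`, and the key estimate applies to each exponent.
* If `1/2 < β ≤ 29/50`, the inequality `x y ≤ (x² + y²) / 2` separates the largest coefficient from
  the others; the product over the others then occurs squared, which makes all exponents at least `2`.
* If `β ≥ 29/50`, averaging over the variable with the largest coefficient alone gives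
  `|b| (1 + u / 4 - u² / 256)`, where `u = |g / b|²` and `g` is the rest of the sum, and the second
  and fourth moments of `g` suffice.
-/

/-! ### Taylor bounds for sine and cosine -/

theorem le_of_hasDerivAt_le_of_nonneg {f g f' g' : ℝ → ℝ} (hf : ∀ x, HasDerivAt f (f' x) x)
    (hg : ∀ x, HasDerivAt g (g' x) x) (h0 : f 0 ≤ g 0) (h : ∀ x, 0 ≤ x → f' x ≤ g' x)
    {x : ℝ} (hx : 0 ≤ x) : f x ≤ g x := by
  have hmono : MonotoneOn (fun x => g x - f x) (Set.Ici 0) := by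
    refine monotoneOn_of_hasDerivWithinAt_nonneg (f' := fun x => g' x - f' x) (convex_Ici 0) ?_ ?_ ?_
    · exact fun x _ => ((hg x).sub (hf x)).continuousAt.continuousWithinAt
    · exact fun x _ => ((hg x).sub (hf x)).hasDerivWithinAt
    · intro x hx
      rw [interior_Ici] at hx
      exact sub_nonneg.2 (h x (le_of_lt hx))
  have := hmono (Set.mem_Ici.2 le_rfl) (Set.mem_Ici.2 hx) hx
  simp only at this
  linarith

/-- The Taylor polynomial of `cos` with `n` nonzero terms. -/
noncomputable def cosTaylor (n : ℕ) (x : ℝ) : ℝ :=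
  ∑ k ∈ Finset.range n, (-1) ^ k / (2 * k).factorial * x ^ (2 * k)

/-- The Taylor polynomial of `sin` with `n` nonzero terms. -/
noncomputable def sinTaylor (n : ℕ) (x : ℝ) : ℝ :=
  ∑ k ∈ Finset.range n, (-1) ^ k / (2 * k + 1).factorial * x ^ (2 * k + 1)

theorem hasDerivAt_sinTaylor (n : ℕ) (x : ℝ) : HasDerivAt (sinTaylor n) (cosTaylor n x) x := by
  unfold sinTaylor cosTaylor
  refine HasDerivAt.fun_sum fun k _ => ?_
  have h := (hasDerivAt_pow (2 * k + 1) x).const_mul (((-1 : ℝ)) ^ k / (2 * k + 1).factorial)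
  refine h.congr_deriv ?_
  rw [Nat.factorial_succ, Nat.add_sub_cancel]
  push_cast
  have : ((2 * k).factorial : ℝ) ≠ 0 := by positivity
  have : (2 * (k : ℝ) + 1) ≠ 0 := by positivity
  field_simp

theorem hasDerivAt_cosTaylor (n : ℕ) (x : ℝ) :
    HasDerivAt (cosTaylor (n + 1)) (-sinTaylor n x) x := by
  unfold sinTaylor cosTaylor
  simp_rw [Finset.sum_range_succ' _ n]
  rw [← Finset.sum_neg_distrib]
  have h0 : HasDerivAt (fun x : ℝ => (-1 : ℝ) ^ 0 / (2 * 0).factorial * x ^ (2 * 0)) 0 x := by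
    simpa using hasDerivAt_const x (1 : ℝ)
  rw [← add_zero (Finset.sum _ _)]
  refine HasDerivAt.fun_add (HasDerivAt.fun_sum fun k _ => ?_) h0
  have h := (hasDerivAt_pow (2 * (k + 1)) x).const_mul
    (((-1 : ℝ)) ^ (k + 1) / (2 * (k + 1)).factorial)
  refine h.congr_deriv ?_
  rw [show 2 * (k + 1) = (2 * k + 1) + 1 by ring, Nat.factorial_succ, Nat.add_sub_cancel]
  push_cast
  have : ((2 * k + 1).factorial : ℝ) ≠ 0 := by positivity
  have : (2 * (k : ℝ) + 1 + 1) ≠ 0 := by positivity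
  field_simp
  ring

/-- The errors of the Taylor polynomials of `cos` and `sin` alternate in sign on `[0, ∞)`. -/
theorem taylor_cos_sin_alternate (n : ℕ) :
    (∀ x : ℝ, 0 ≤ x → (-1) ^ (n + 1) * cosTaylor (n + 1) x ≤ (-1) ^ (n + 1) * Real.cos x) ∧
    (∀ x : ℝ, 0 ≤ x → (-1) ^ (n + 1) * sinTaylor (n + 1) x ≤ (-1) ^ (n + 1) * Real.sin x) := by
  have key : ∀ n, (∀ x : ℝ, 0 ≤ x → (-1) ^ n * cosTaylor n x ≤ (-1) ^ n * Real.cos x) →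
      ∀ x : ℝ, 0 ≤ x → (-1) ^ n * sinTaylor n x ≤ (-1) ^ n * Real.sin x := by
    intro n h x hx
    refine le_of_hasDerivAt_le_of_nonneg
      (fun x => (hasDerivAt_sinTaylor n x).const_mul _)
      (fun x => (Real.hasDerivAt_sin x).const_mul _) ?_ h hx
    simp [sinTaylor]
  induction n with
  | zero =>
    have h : ∀ x : ℝ, 0 ≤ x →
        (-1) ^ (0 + 1) * cosTaylor (0 + 1) x ≤ (-1) ^ (0 + 1) * Real.cos x := by
      intro x _
      simpa [cosTaylor] using Real.cos_le_one x
    exact ⟨h, key _ h⟩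
  | succ n ih =>
    have h : ∀ x : ℝ, 0 ≤ x →
        (-1) ^ (n + 1 + 1) * cosTaylor (n + 1 + 1) x ≤ (-1) ^ (n + 1 + 1) * Real.cos x := by
      intro x hx
      refine le_of_hasDerivAt_le_of_nonneg
        (fun x => (hasDerivAt_cosTaylor (n + 1) x).const_mul _)
        (fun x => (Real.hasDerivAt_cos x).const_mul _) ?_ ?_ hx
      · simp [cosTaylor, Finset.sum_range_succ']
      · intro x hx
        have := ih.2 x hx
        rw [pow_succ (-1 : ℝ) (n + 1)]
        linarith
    exact ⟨h, key _ h⟩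

theorem cosTaylor_neg (n : ℕ) (x : ℝ) : cosTaylor n (-x) = cosTaylor n x := by
  unfold cosTaylor
  simp [pow_mul]

theorem sinTaylor_neg (n : ℕ) (x : ℝ) : sinTaylor n (-x) = -sinTaylor n x := by
  unfold sinTaylor
  simp [pow_succ, pow_mul]

theorem cosTaylor_alternate (n : ℕ) (x : ℝ) :
    (-1) ^ (n + 1) * cosTaylor (n + 1) x ≤ (-1) ^ (n + 1) * Real.cos x := by
  rcases le_total 0 x with h | h
  · exact (taylor_cos_sin_alternate n).1 x h
  · have := (taylor_cos_sin_alternate n).1 (-x) (by linarith)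
    rwa [cosTaylor_neg, Real.cos_neg] at this

theorem mul_sinTaylor_alternate (n : ℕ) {x : ℝ} (hx : 0 ≤ x) (c : ℝ) :
    (-1) ^ (n + 1) * (c * sinTaylor (n + 1) (x * c)) ≤ (-1) ^ (n + 1) * (c * Real.sin (x * c)) := by
  rcases le_total 0 c with h | h
  · have := mul_le_mul_of_nonneg_left
      ((taylor_cos_sin_alternate n).2 (x * c) (mul_nonneg hx h)) h
    linarith
  · have := mul_le_mul_of_nonneg_left
      ((taylor_cos_sin_alternate n).2 (x * -c) (mul_nonneg hx (by linarith)))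
      (show 0 ≤ -c by linarith)
    rw [mul_neg, sinTaylor_neg, Real.sin_neg] at this
    linarith

/-! ### The Bessel functions of orders zero and one -/

/-- The average of a function of `t` over a period `[0, 2π]`. -/
noncomputable def periodAvg (g : ℝ → ℝ) : ℝ := (2 * Real.pi)⁻¹ * ∫ t in (0)..(2 * Real.pi), g t

/-- The Bessel function `J₀`, as the average of `cos (x cos t)`. -/
noncomputable def besselJ0 (x : ℝ) : ℝ := periodAvg fun t => Real.cos (x * Real.cos t)

/-- The Bessel function `J₁`, as the average of `cos t sin (x cos t)`. -/
noncomputable def besselJ1 (x : ℝ) : ℝ :=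
  periodAvg fun t => Real.cos t * Real.sin (x * Real.cos t)

theorem periodAvg_mono {f g : ℝ → ℝ} (hf : Continuous f) (hg : Continuous g)
    (h : ∀ t, f t ≤ g t) : periodAvg f ≤ periodAvg g := by
  refine mul_le_mul_of_nonneg_left ?_ (by positivity)
  exact intervalIntegral.integral_mono (by positivity) (hf.intervalIntegrable _ _)
    (hg.intervalIntegrable _ _) h

theorem periodAvg_const_mul (c : ℝ) (f : ℝ → ℝ) :
    periodAvg (fun t => c * f t) = c * periodAvg f := by
  unfold periodAvg
  rw [intervalIntegral.integral_const_mul]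
  ring

theorem periodAvg_sub {f g : ℝ → ℝ} (hf : Continuous f) (hg : Continuous g) :
    periodAvg (fun t => f t - g t) = periodAvg f - periodAvg g := by
  unfold periodAvg
  rw [intervalIntegral.integral_sub (hf.intervalIntegrable _ _) (hg.intervalIntegrable _ _)]
  ring

theorem periodAvg_sum {n : ℕ} {f : ℕ → ℝ → ℝ} (hf : ∀ k, Continuous (f k)) :
    periodAvg (fun t => ∑ k ∈ Finset.range n, f k t) = ∑ k ∈ Finset.range n, periodAvg (f k) := by
  unfold periodAvg
  rw [intervalIntegral.integral_finsetSum fun k _ => (hf k).intervalIntegrable _ _,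
    Finset.mul_sum]

theorem periodAvg_const (c : ℝ) : periodAvg (fun _ => c) = c := by
  have := Real.pi_pos
  simp [periodAvg]
  field_simp

/-- The average of `cos t ^ (2 k)`. -/
noncomputable def cosMoment (k : ℕ) : ℝ := periodAvg fun t => Real.cos t ^ (2 * k)

theorem cosMoment_zero : cosMoment 0 = 1 := by
  simpa [cosMoment] using periodAvg_const 1

theorem cosMoment_succ (k : ℕ) :
    cosMoment (k + 1) = (2 * k + 1) / (2 * k + 2) * cosMoment k := by
  unfold cosMoment periodAvg
  rw [show 2 * (k + 1) = 2 * k + 2 by ring, integral_cos_pow]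
  simp
  ring

theorem besselJ0_alternate (n : ℕ) (x : ℝ) :
    (-1) ^ (n + 1) * ∑ k ∈ Finset.range (n + 1),
      (-1) ^ k / (2 * k).factorial * cosMoment k * x ^ (2 * k) ≤ (-1) ^ (n + 1) * besselJ0 x := by
  unfold besselJ0
  rw [← periodAvg_const_mul]
  have h : (-1) ^ (n + 1) * ∑ k ∈ Finset.range (n + 1),
      (-1) ^ k / (2 * k).factorial * cosMoment k * x ^ (2 * k) =
      periodAvg fun t => (-1) ^ (n + 1) * cosTaylor (n + 1) (x * Real.cos t) := by
    rw [periodAvg_const_mul]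
    unfold cosTaylor
    rw [periodAvg_sum (f := fun k t => (-1) ^ k / (2 * k).factorial * (x * Real.cos t) ^ (2 * k))
      (fun k => by fun_prop)]
    congr 1
    refine Finset.sum_congr rfl fun k _ => ?_
    simp_rw [mul_pow, ← mul_assoc]
    rw [periodAvg_const_mul, cosMoment]
    ring
  rw [h]
  refine periodAvg_mono ?_ (by fun_prop) fun t => cosTaylor_alternate n _
  unfold cosTaylor
  fun_prop

theorem besselJ1_alternate (n : ℕ) {x : ℝ} (hx : 0 ≤ x) :
    (-1) ^ (n + 1) * ∑ k ∈ Finset.range (n + 1),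
      (-1) ^ k / (2 * k + 1).factorial * cosMoment (k + 1) * x ^ (2 * k + 1) ≤
        (-1) ^ (n + 1) * besselJ1 x := by
  unfold besselJ1
  rw [← periodAvg_const_mul]
  have h : (-1) ^ (n + 1) * ∑ k ∈ Finset.range (n + 1),
      (-1) ^ k / (2 * k + 1).factorial * cosMoment (k + 1) * x ^ (2 * k + 1) =
      periodAvg fun t => (-1) ^ (n + 1) * (Real.cos t * sinTaylor (n + 1) (x * Real.cos t)) := by
    rw [periodAvg_const_mul]
    unfold sinTaylor
    simp_rw [Finset.mul_sum]
    rw [← Finset.mul_sum, periodAvg_sum (f := fun k t =>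
      Real.cos t * ((-1) ^ k / (2 * k + 1).factorial * (x * Real.cos t) ^ (2 * k + 1)))
      (fun k => by fun_prop)]
    congr 1
    refine Finset.sum_congr rfl fun k _ => ?_
    have : (fun t => Real.cos t *
        ((-1) ^ k / (2 * k + 1).factorial * (x * Real.cos t) ^ (2 * k + 1))) =
        fun t => ((-1) ^ k / (2 * k + 1).factorial * x ^ (2 * k + 1)) *
          Real.cos t ^ (2 * (k + 1)) := by
      funext t
      rw [mul_pow]
      ring
    rw [this, periodAvg_const_mul, cosMoment]
    ring
  rw [h]
  refine periodAvg_mono ?_ (by fun_prop) fun t => mul_sinTaylor_alternate n hx _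
  unfold sinTaylor
  fun_prop

theorem hasDerivAt_periodAvg {F F' : ℝ → ℝ → ℝ} (hF : ∀ x, Continuous (F x))
    (hF' : ∀ x, Continuous (F' x)) (hb : ∀ x t, |F' x t| ≤ 1)
    (hd : ∀ x t, HasDerivAt (fun x => F x t) (F' x t) x) (x : ℝ) :
    HasDerivAt (fun x => periodAvg (F x)) (periodAvg (F' x)) x := by
  refine HasDerivAt.const_mul _ ?_
  refine (intervalIntegral.hasDerivAt_integral_of_dominated_loc_of_deriv_le
    (bound := fun _ => 1) Filter.univ_mem ?_ ?_ ?_ ?_ ?_ ?_).2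
  · exact Filter.Eventually.of_forall fun x => (hF x).aestronglyMeasurable
  · exact (hF x).intervalIntegrable _ _
  · exact (hF' x).aestronglyMeasurable
  · exact Filter.Eventually.of_forall fun t _ x _ => hb x t
  · exact intervalIntegrable_const
  · exact Filter.Eventually.of_forall fun t _ x _ => hd x t

theorem hasDerivAt_besselJ0 (x : ℝ) : HasDerivAt besselJ0 (-besselJ1 x) x := by
  have h := hasDerivAt_periodAvg (F := fun x t => Real.cos (x * Real.cos t))
    (F' := fun x t => -1 * (Real.cos t * Real.sin (x * Real.cos t)))
    (fun x => by fun_prop) (fun x => by fun_prop) ?_ ?_ x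
  · rw [periodAvg_const_mul, neg_one_mul] at h
    exact h
  · intro x t
    rw [neg_one_mul, abs_neg, abs_mul]
    exact mul_le_one₀ (Real.abs_cos_le_one _) (abs_nonneg _) (Real.abs_sin_le_one _)
  · intro x t
    refine ((hasDerivAt_mul_const (Real.cos t)).cos).congr_deriv ?_
    ring

theorem hasDerivAt_besselJ1_aux (x : ℝ) : HasDerivAt besselJ1
    (periodAvg fun t => Real.cos t ^ 2 * Real.cos (x * Real.cos t)) x := by
  refine hasDerivAt_periodAvg (F := fun x t => Real.cos t * Real.sin (x * Real.cos t))
    (F' := fun x t => Real.cos t ^ 2 * Real.cos (x * Real.cos t))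
    (fun x => by fun_prop) (fun x => by fun_prop) ?_ ?_ x
  · intro x t
    rw [abs_mul, abs_pow]
    exact mul_le_one₀ (pow_le_one₀ (abs_nonneg _) (Real.abs_cos_le_one _)) (abs_nonneg _)
      (Real.abs_cos_le_one _)
  · intro x t
    refine (((hasDerivAt_mul_const (Real.cos t)).sin).const_mul _).congr_deriv ?_
    ring

/-- An integration by parts over the period; together with the derivatives of `J₀` and `J₁` it is
Bessel's differential equation. -/
theorem besselJ1_eq (x : ℝ) : besselJ1 x = x * (besselJ0 x -
    periodAvg fun t => Real.cos t ^ 2 * Real.cos (x * Real.cos t)) := by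
  have h : periodAvg (fun t => Real.cos t * Real.sin (x * Real.cos t) -
      x * (Real.cos (x * Real.cos t) - Real.cos t ^ 2 * Real.cos (x * Real.cos t))) = 0 := by
    unfold periodAvg
    rw [intervalIntegral.integral_eq_sub_of_hasDerivAt
      (f := fun t => Real.sin t * Real.sin (x * Real.cos t))]
    · simp
    · intro t _
      refine ((Real.hasDerivAt_sin t).mul
        (((Real.hasDerivAt_cos t).const_mul x).sin)).congr_deriv ?_
      have := Real.sin_sq t
      linear_combination (-x * Real.cos (x * Real.cos t)) * this
    · exact Continuous.intervalIntegrable (by fun_prop) _ _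
  rw [periodAvg_sub (by fun_prop) (by fun_prop), periodAvg_const_mul,
    periodAvg_sub (by fun_prop) (by fun_prop)] at h
  exact sub_eq_zero.1 h

theorem continuous_besselJ0 : Continuous besselJ0 :=
  continuous_iff_continuousAt.2 fun x => (hasDerivAt_besselJ0 x).continuousAt

/-- The energy `J₀² + J₁²` decreases on `(0, ∞)`: its derivative is `-2 J₁² / x`. -/
theorem besselEnergy_antitoneOn :
    AntitoneOn (fun x => besselJ0 x ^ 2 + besselJ1 x ^ 2) (Set.Ioi 0) := by
  have hd : ∀ x, HasDerivAt (fun x => besselJ0 x ^ 2 + besselJ1 x ^ 2) _ x := fun x =>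
    ((hasDerivAt_besselJ0 x).pow 2).add ((hasDerivAt_besselJ1_aux x).pow 2)
  refine antitoneOn_of_hasDerivWithinAt_nonpos (convex_Ioi 0)
    (fun x _ => (hd x).continuousAt.continuousWithinAt) (fun x _ => (hd x).hasDerivWithinAt) ?_
  intro x hx
  rw [interior_Ioi, Set.mem_Ioi] at hx
  have h := besselJ1_eq x
  set D := periodAvg fun t => Real.cos t ^ 2 * Real.cos (x * Real.cos t)
  have : besselJ0 x = D + besselJ1 x / x := by
    rw [h]; field_simp; ring
  rw [this]
  have h2 : 0 ≤ besselJ1 x ^ 2 / x := by positivity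
  have h3 : besselJ1 x ^ 2 / x = besselJ1 x * (besselJ1 x / x) := by ring
  rw [h3] at h2
  simp
  linarith

theorem abs_besselJ0_le_one (x : ℝ) : |besselJ0 x| ≤ 1 := by
  rw [abs_le]
  constructor
  · have := periodAvg_mono (f := fun _ => -1) (g := fun t => Real.cos (x * Real.cos t))
      (by fun_prop) (by fun_prop) (fun t => Real.neg_one_le_cos _)
    rwa [periodAvg_const] at this
  · have := periodAvg_mono (f := fun t => Real.cos (x * Real.cos t)) (g := fun _ => 1)
      (by fun_prop) (by fun_prop) (fun t => Real.cos_le_one _)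
    rwa [periodAvg_const] at this

theorem besselJ0_zero : besselJ0 0 = 1 := by
  simpa [besselJ0] using periodAvg_const 1

theorem besselJ0_ge (x : ℝ) : 1 - x ^ 2 / 4 ≤ besselJ0 x := by
  have := besselJ0_alternate 1 x
  simp [Finset.sum_range_succ, cosMoment_succ, cosMoment_zero, Nat.factorial] at this
  linarith

theorem besselJ0_le (x : ℝ) : besselJ0 x ≤ (1 - x ^ 2 / 8) ^ 2 := by
  have := besselJ0_alternate 2 x
  simp [Finset.sum_range_succ, cosMoment_succ, cosMoment_zero, Nat.factorial] at this
  norm_num at this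
  linarith

theorem abs_besselJ0_le_exp {x : ℝ} (hx : x ^ 2 ≤ 4) :
    |besselJ0 x| ≤ Real.exp (-x ^ 2 / 4) := by
  have h0 := besselJ0_ge x
  rw [abs_of_nonneg (by linarith)]
  refine (besselJ0_le x).trans ?_
  have h1 := Real.add_one_le_exp (-x ^ 2 / 8)
  calc (1 - x ^ 2 / 8) ^ 2 ≤ Real.exp (-x ^ 2 / 8) ^ 2 := by
        apply pow_le_pow_left₀ <;> linarith
    _ = Real.exp (-x ^ 2 / 4) := by
        rw [← Real.exp_nat_mul]; congr 1; push_cast; ring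

/-- Away from the origin `|J₀|` is small: up to `16/5` by the Taylor polynomials, from there on by
the energy at `16/5`. (The true maximum is about `0.4028`.) -/
theorem abs_besselJ0_le_of_ge {x : ℝ} (hx : 46 / 25 ≤ x) : |besselJ0 x| ≤ 107 / 250 := by
  rcases le_total x (16 / 5) with h | h
  · have h1 := besselJ0_le x
    have h2 := besselJ0_alternate 3 x
    simp [Finset.sum_range_succ, cosMoment_succ, cosMoment_zero, Nat.factorial] at h2
    norm_num at h2
    have hy1 : (46 / 25) ^ 2 ≤ x ^ 2 := by gcongr
    have hy2 : x ^ 2 ≤ (16 / 5) ^ 2 := by gcongr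
    rw [show x ^ 4 = (x ^ 2) ^ 2 by ring, show x ^ 6 = (x ^ 2) ^ 3 by ring] at h2
    set y := x ^ 2
    rw [abs_le]
    constructor
    · have : 0 ≤ (256 / 25 - y) * (1 / 4 - (y + 256 / 25) / 64 +
          (y ^ 2 + y * (256 / 25) + (256 / 25) ^ 2) / 2304) := by
        refine mul_nonneg (by linarith) ?_
        nlinarith [sq_nonneg (y - 13)]
      nlinarith
    · nlinarith
  · have h1 := besselEnergy_antitoneOn (show (0 : ℝ) < 16 / 5 by norm_num)
      (show (0 : ℝ) < x by linarith) h
    simp only at h1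
    have a1 := besselJ0_alternate 5 (16 / 5)
    have a2 := besselJ0_le (16 / 5)
    have a2' := besselJ0_alternate 4 (16 / 5)
    have a3 := besselJ1_alternate 4 (show (0 : ℝ) ≤ 16 / 5 by norm_num)
    have a4 := besselJ1_alternate 3 (show (0 : ℝ) ≤ 16 / 5 by norm_num)
    simp [Finset.sum_range_succ, cosMoment_succ, cosMoment_zero, Nat.factorial] at a1 a2' a3 a4
    norm_num at a1 a2' a3 a4
    have b1 : besselJ0 (16 / 5) ^ 2 ≤ (321 / 1000) ^ 2 := by
      apply sq_le_sq' <;> linarith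
    have b2 : besselJ1 (16 / 5) ^ 2 ≤ (264 / 1000) ^ 2 := by
      apply sq_le_sq' <;> linarith
    apply abs_le_of_sq_le_sq _ (by norm_num)
    nlinarith [sq_nonneg (besselJ1 x)]

/-! ### Integrals against `dt / t²` on the half-line -/

/-- The bound behind every integral against `dt / t²` below. -/
theorem abs_div_sq_le {y A B t : ℝ} (ht : 0 < t) (hA : |y| ≤ A) (hB : |y| ≤ B * t ^ 2) :
    |y / t ^ 2| ≤ (A + B) * (1 + t ^ 2)⁻¹ := by
  rw [abs_div, abs_of_pos (pow_pos ht 2), ← div_eq_mul_inv, div_le_div_iff₀ (by positivity)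
    (by positivity)]
  nlinarith [pow_pos ht 2]

theorem integrableOn_div_sq {h : ℝ → ℝ} (hm : Measurable h) {A B : ℝ}
    (hA : ∀ t, 0 < t → |h t| ≤ A) (hB : ∀ t, 0 < t → |h t| ≤ B * t ^ 2) :
    IntegrableOn (fun t => h t / t ^ 2) (Set.Ioi 0) := by
  refine Integrable.mono' ((integrable_inv_one_add_sq.const_mul (A + B)).integrableOn) ?_ ?_
  · exact (hm.div (by fun_prop)).aestronglyMeasurable
  · refine (ae_restrict_iff' measurableSet_Ioi).2 (Filter.Eventually.of_forall fun t ht => ?_)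
    exact abs_div_sq_le ht (hA t ht) (hB t ht)

theorem abs_one_sub_exp_neg_le {a : ℝ} (ha : 0 ≤ a) (t : ℝ) :
    |1 - Real.exp (-a * t ^ 2)| ≤ 1 ∧ |1 - Real.exp (-a * t ^ 2)| ≤ a * t ^ 2 := by
  have h1 := Real.add_one_le_exp (-a * t ^ 2)
  have h2 : Real.exp (-a * t ^ 2) ≤ 1 := by
    rw [Real.exp_le_one_iff]
    nlinarith [sq_nonneg t, mul_nonneg ha (sq_nonneg t)]
  have h3 := Real.exp_pos (-a * t ^ 2)
  rw [abs_of_nonneg (by linarith)]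
  exact ⟨by linarith, by linarith⟩

theorem integrableOn_one_sub_exp_div_sq {a : ℝ} (ha : 0 ≤ a) :
    IntegrableOn (fun t : ℝ => (1 - Real.exp (-a * t ^ 2)) / t ^ 2) (Set.Ioi 0) :=
  integrableOn_div_sq (by fun_prop) (fun t _ => (abs_one_sub_exp_neg_le ha t).1)
    (fun t _ => (abs_one_sub_exp_neg_le ha t).2)

theorem integral_one_sub_exp_div_sq {a : ℝ} (ha : 0 < a) :
    ∫ t in Set.Ioi (0 : ℝ), (1 - Real.exp (-a * t ^ 2)) / t ^ 2 = √(Real.pi * a) := by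
  -- `-(1 - exp (-a t²)) / t` is a primitive of the integrand minus `2 a exp (-a t²)`
  have hg : IntegrableOn (fun t : ℝ => 2 * a * Real.exp (-a * t ^ 2)) (Set.Ioi 0) :=
    ((integrable_exp_neg_mul_sq ha).const_mul _).integrableOn
  have hi := integrableOn_one_sub_exp_div_sq ha.le
  have key : ∫ t in Set.Ioi (0 : ℝ), ((1 - Real.exp (-a * t ^ 2)) / t ^ 2 -
      2 * a * Real.exp (-a * t ^ 2)) = 0 - -((1 - Real.exp (-a * 0 ^ 2)) / 0) := by
    refine integral_Ioi_of_hasDerivAt_of_tendsto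
      (f := fun t => -((1 - Real.exp (-a * t ^ 2)) / t)) ?_ ?_ (hi.sub hg) ?_
    · refine ContinuousAt.continuousWithinAt ?_
      rw [ContinuousAt]
      simp only [div_zero, neg_zero]
      have hz : Filter.Tendsto (fun t : ℝ => a * |t|) (nhds 0) (nhds 0) := by
        have : Continuous fun t : ℝ => a * |t| := by fun_prop
        simpa using this.tendsto 0
      refine squeeze_zero_norm (fun t => ?_) hz
      rw [norm_neg, Real.norm_eq_abs, abs_div]
      refine div_le_of_le_mul₀ (abs_nonneg _) (by positivity) ?_
      rw [mul_assoc, abs_mul_abs_self, ← sq]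
      exact (abs_one_sub_exp_neg_le ha.le t).2
    · intro t ht
      have ht' : t ≠ 0 := ne_of_gt ht
      have h1 : HasDerivAt (fun t : ℝ => -a * t ^ 2) (-a * (2 * t)) t := by
        simpa using (hasDerivAt_pow 2 t).const_mul (-a)
      refine (((h1.exp.const_sub 1).div (hasDerivAt_id t) ht').neg).congr_deriv ?_
      simp only [id]
      field_simp
      ring
    · refine squeeze_zero_norm' ?_ (tendsto_inv_atTop_zero (𝕜 := ℝ))
      filter_upwards [Filter.eventually_gt_atTop 0] with t ht
      rw [norm_neg, Real.norm_eq_abs, abs_div, abs_of_pos ht, inv_eq_one_div]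
      gcongr
      exact (abs_one_sub_exp_neg_le ha.le t).1
  rw [integral_sub hi hg, integral_const_mul, integral_gaussian_Ioi, div_zero, neg_zero,
    sub_zero, sub_eq_zero] at key
  rw [key]
  have : Real.pi * a = Real.pi / a * a ^ 2 := by field_simp
  rw [this, Real.sqrt_mul (by positivity), Real.sqrt_sq ha.le]
  ring

theorem integral_exp_div_sq_tail_le {c : ℝ} (hc : √2 ≤ c) :
    ∫ t in Set.Ioi c, Real.exp (-t ^ 2 / 2) / t ^ 2 ≤ Real.exp (-c ^ 2 / 2) / (c ^ 3 + 2 * c) := by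
  have h2 : (0 : ℝ) < √2 := by positivity
  have hc0 : 0 < c := by linarith
  have hd : ∀ t ∈ Set.Ici c, HasDerivAt (fun t => -(Real.exp (-t ^ 2 / 2) / (t ^ 3 + 2 * t)))
      (Real.exp (-t ^ 2 / 2) * (t / (t ^ 3 + 2 * t) + (3 * t ^ 2 + 2) / (t ^ 3 + 2 * t) ^ 2)) t := by
    intro t ht
    have ht0 : 0 < t := lt_of_lt_of_le hc0 ht
    have h1 : HasDerivAt (fun t : ℝ => -t ^ 2 / 2) (-t) t := by
      refine ((hasDerivAt_pow 2 t).neg.div_const 2).congr_deriv ?_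
      push_cast
      ring
    have h3 : HasDerivAt (fun t : ℝ => t ^ 3 + 2 * t) (3 * t ^ 2 + 2) t := by
      refine ((hasDerivAt_pow 3 t).add ((hasDerivAt_id t).const_mul 2)).congr_deriv ?_
      simp
    refine ((h1.exp.div h3 (by positivity)).neg).congr_deriv ?_
    field_simp
    ring
  have hpos : ∀ t ∈ Set.Ioi c, 0 ≤
      Real.exp (-t ^ 2 / 2) * (t / (t ^ 3 + 2 * t) + (3 * t ^ 2 + 2) / (t ^ 3 + 2 * t) ^ 2) := by
    intro t ht
    have ht0 : 0 < t := lt_trans hc0 ht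
    positivity
  have hlim : Filter.Tendsto (fun t : ℝ => -(Real.exp (-t ^ 2 / 2) / (t ^ 3 + 2 * t)))
      Filter.atTop (nhds 0) := by
    refine squeeze_zero_norm' ?_ (tendsto_inv_atTop_zero (𝕜 := ℝ))
    filter_upwards [Filter.eventually_gt_atTop 0] with t ht
    rw [norm_neg, Real.norm_eq_abs, abs_of_pos (by positivity), inv_eq_one_div]
    apply div_le_div₀ (by norm_num) _ ht
    · nlinarith [pow_pos ht 3]
    · rw [Real.exp_le_one_iff]
      nlinarith [sq_nonneg t]
  have hint := integrableOn_Ioi_deriv_of_nonneg' hd hpos hlim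
  have heq := integral_Ioi_of_hasDerivAt_of_tendsto' hd hint hlim
  rw [zero_sub, neg_neg] at heq
  rw [← heq]
  refine integral_mono_of_nonneg (Filter.Eventually.of_forall fun t => by positivity) hint ?_
  refine (ae_restrict_iff' measurableSet_Ioi).2 (Filter.Eventually.of_forall fun t ht => ?_)
  have ht0 : 0 < t := lt_trans hc0 ht
  have ht2 : 2 ≤ t ^ 2 := by
    have : √2 < t := lt_of_le_of_lt hc ht
    have := pow_le_pow_left₀ h2.le this.le 2
    rwa [Real.sq_sqrt (by norm_num)] at this
  simp only
  rw [div_eq_mul_inv (Real.exp _)]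
  refine mul_le_mul_of_nonneg_left ?_ (Real.exp_pos _).le
  rw [show t / (t ^ 3 + 2 * t) + (3 * t ^ 2 + 2) / (t ^ 3 + 2 * t) ^ 2 =
    (t * (t ^ 3 + 2 * t) + (3 * t ^ 2 + 2)) / (t ^ 3 + 2 * t) ^ 2 by field_simp, inv_eq_one_div,
    div_le_div_iff₀ (by positivity) (by positivity)]
  nlinarith [mul_nonneg (sq_nonneg t) (sub_nonneg.2 ht2)]

theorem abs_one_sub_cos_le (x : ℝ) : |1 - Real.cos x| ≤ 2 ∧ |1 - Real.cos x| ≤ x ^ 2 / 2 := by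
  have h1 := Real.cos_le_one x
  have h2 := Real.neg_one_le_cos x
  have h3 := Real.one_sub_sq_div_two_le_cos (x := x)
  rw [abs_of_nonneg (by linarith)]
  exact ⟨by linarith, by linarith⟩

/-- Scaling in an integral against `dt / t²`. -/
theorem integral_comp_mul_div_sq (h : ℝ → ℝ) {r : ℝ} (hr : 0 < r) :
    ∫ t in Set.Ioi (0 : ℝ), h (r * t) / t ^ 2 = r * ∫ t in Set.Ioi (0 : ℝ), h t / t ^ 2 := by
  have := integral_comp_mul_left_Ioi (fun t => h t / t ^ 2) 0 hr
  rw [mul_zero, smul_eq_mul] at this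
  have h2 : ∀ t : ℝ, h (r * t) / t ^ 2 = r ^ 2 * (h (r * t) / (r * t) ^ 2) := by
    intro t
    rcases eq_or_ne t 0 with rfl | ht
    · simp
    · field_simp
  simp_rw [h2]
  rw [integral_const_mul, this]
  field_simp

theorem integral_one_sub_cos_mul_div_sq (x : ℝ) :
    ∫ t in Set.Ioi (0 : ℝ), (1 - Real.cos (t * x)) / t ^ 2 =
      |x| * ∫ t in Set.Ioi (0 : ℝ), (1 - Real.cos t) / t ^ 2 := by
  rcases eq_or_ne x 0 with rfl | hx
  · simp
  · rw [← integral_comp_mul_div_sq (fun t => 1 - Real.cos t) (abs_pos.2 hx)]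
    refine integral_congr_ae (Filter.Eventually.of_forall fun t => ?_)
    simp only
    rw [← Real.cos_abs (t * x), ← Real.cos_abs (|x| * t), abs_mul, abs_mul, abs_abs, mul_comm]

theorem integral_one_sub_cos_mul_exp (t : ℝ) :
    ∫ x : ℝ, (1 - Real.cos (t * x)) * Real.exp (-(1 / 2) * x ^ 2) =
      √(2 * Real.pi) * (1 - Real.exp (-(1 / 2) * t ^ 2)) := by
  have hg : Integrable fun x : ℝ => Real.exp (-(1 / 2) * x ^ 2) :=
    integrable_exp_neg_mul_sq (by norm_num)
  have hc : Integrable fun x : ℝ => Real.cos (t * x) * Real.exp (-(1 / 2) * x ^ 2) := by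
    refine hg.mono' (by fun_prop) (Filter.Eventually.of_forall fun x => ?_)
    rw [norm_mul, Real.norm_eq_abs, Real.norm_eq_abs, Real.abs_exp]
    exact mul_le_of_le_one_left (Real.exp_pos _).le (Real.abs_cos_le_one _)
  have h1 : ∫ x : ℝ, Real.cos (t * x) * Real.exp (-(1 / 2) * x ^ 2) =
      √(2 * Real.pi) * Real.exp (-(1 / 2) * t ^ 2) := by
    have h := fourierIntegral_gaussian (b := ((1 / 2 : ℝ) : ℂ)) (by norm_num) (t : ℂ)
    have h2 : (fun x : ℝ => Real.cos (t * x) * Real.exp (-(1 / 2) * x ^ 2)) = fun x : ℝ =>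
        RCLike.re (Complex.exp (Complex.I * t * x) * Complex.exp (-((1 / 2 : ℝ) : ℂ) * x ^ 2)) := by
      funext x
      rw [show Complex.I * (t : ℂ) * x = ((t * x : ℝ) : ℂ) * Complex.I by push_cast; ring,
        show -((1 / 2 : ℝ) : ℂ) * (x : ℂ) ^ 2 = ((-(1 / 2) * x ^ 2 : ℝ) : ℂ) by push_cast; ring,
        ← Complex.ofReal_exp, RCLike.re_to_complex, Complex.re_mul_ofReal,
        Complex.exp_ofReal_mul_I_re]
    rw [h2, integral_re, h]
    · rw [← Complex.ofReal_div, show ((1 : ℂ) / 2) = ((1 / 2 : ℝ) : ℂ) by push_cast; rfl,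
        ← Complex.ofReal_cpow (by positivity),
        show -(t : ℂ) ^ 2 / (4 * ((1 / 2 : ℝ) : ℂ)) = ((-(1 / 2) * t ^ 2 : ℝ) : ℂ) by
          push_cast; ring,
        ← Complex.ofReal_exp, ← Complex.ofReal_mul]
      simp only [RCLike.re_to_complex, Complex.ofReal_re]
      rw [← Real.sqrt_eq_rpow]
      congr 2
      ring
    · refine hg.mono' (by fun_prop) (Filter.Eventually.of_forall fun x => ?_)
      rw [norm_mul, Complex.norm_exp, Complex.norm_exp]
      simp [← Complex.ofReal_pow]
  have h3 : ∀ x : ℝ, (1 - Real.cos (t * x)) * Real.exp (-(1 / 2) * x ^ 2) =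
      Real.exp (-(1 / 2) * x ^ 2) - Real.cos (t * x) * Real.exp (-(1 / 2) * x ^ 2) :=
    fun x => by ring
  simp_rw [h3]
  rw [integral_sub hg hc, h1, integral_gaussian]
  rw [show Real.pi / (1 / 2) = 2 * Real.pi by ring]
  ring

theorem integral_abs_mul_exp : ∫ x : ℝ, |x| * Real.exp (-(1 / 2) * x ^ 2) = 2 := by
  have h := integral_comp_abs (f := fun x : ℝ => x * Real.exp (-(1 / 2) * x ^ 2))
  simp only [sq_abs] at h
  rw [h]
  have hd : ∀ x ∈ Set.Ici (0 : ℝ), HasDerivAt (fun x : ℝ => -Real.exp (-(1 / 2) * x ^ 2))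
      (x * Real.exp (-(1 / 2) * x ^ 2)) x := by
    intro x _
    have h1 : HasDerivAt (fun t : ℝ => -(1 / 2) * t ^ 2) (-(1 / 2) * (2 * x)) x := by
      refine ((hasDerivAt_pow 2 x).const_mul (-(1 / 2))).congr_deriv ?_
      push_cast
      ring
    refine h1.exp.neg.congr_deriv ?_
    ring
  rw [integral_Ioi_of_hasDerivAt_of_tendsto' hd
    (integrable_mul_exp_neg_mul_sq (by norm_num)).integrableOn (m := 0)]
  · simp
  · rw [← neg_zero]
    refine Filter.Tendsto.neg (Real.tendsto_exp_atBot.comp ?_)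
    exact Filter.Tendsto.const_mul_atTop_of_neg (by norm_num)
      (Filter.tendsto_pow_atTop (by norm_num))

/-- `∫₀^∞ (1 - cos t) / t² dt = π / 2`, by integrating `(1 - cos (t x)) / t²` against the Gaussian
weight `exp (-x² / 2)` in both orders. -/
theorem integral_one_sub_cos_div_sq :
    ∫ t in Set.Ioi (0 : ℝ), (1 - Real.cos t) / t ^ 2 = Real.pi / 2 := by
  have hswap := integral_integral_swap (μ := (volume : Measure ℝ))
    (ν := volume.restrict (Set.Ioi (0 : ℝ)))
    (f := fun x t => (1 - Real.cos (t * x)) / t ^ 2 * Real.exp (-(1 / 2) * x ^ 2)) ?_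
  · simp_rw [integral_mul_const, integral_one_sub_cos_mul_div_sq] at hswap
    have h1 : ∀ c : ℝ, ∫ x : ℝ, |x| * c * Real.exp (-(1 / 2) * x ^ 2) = 2 * c := by
      intro c
      simp_rw [mul_right_comm _ c]
      rw [integral_mul_const, integral_abs_mul_exp]
    have h2 : ∀ t : ℝ, ∫ x : ℝ, (1 - Real.cos (t * x)) / t ^ 2 * Real.exp (-(1 / 2) * x ^ 2) =
        √(2 * Real.pi) * ((1 - Real.exp (-(1 / 2) * t ^ 2)) / t ^ 2) := by
      intro t
      simp_rw [div_mul_eq_mul_div]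
      rw [integral_div, integral_one_sub_cos_mul_exp]
      ring
    simp_rw [h2] at hswap
    rw [h1, integral_const_mul, integral_one_sub_exp_div_sq (by norm_num),
      ← Real.sqrt_mul (by positivity),
      show 2 * Real.pi * (Real.pi * (1 / 2)) = Real.pi ^ 2 by ring,
      Real.sqrt_sq Real.pi_pos.le] at hswap
    linarith
  · have hdom : Integrable (fun z : ℝ × ℝ => ((2 + z.1 ^ 2 / 2) * Real.exp (-(1 / 2) * z.1 ^ 2)) *
        (1 + z.2 ^ 2)⁻¹) ((volume : Measure ℝ).prod (volume.restrict (Set.Ioi (0 : ℝ)))) := by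
      refine Integrable.mul_prod (f := fun x : ℝ => (2 + x ^ 2 / 2) * Real.exp (-(1 / 2) * x ^ 2))
        (g := fun t : ℝ => (1 + t ^ 2)⁻¹) ?_ integrable_inv_one_add_sq.restrict
      simp_rw [add_mul]
      refine ((integrable_exp_neg_mul_sq (by norm_num)).const_mul 2).add ?_
      have := (integrable_rpow_mul_exp_neg_mul_sq (b := 1 / 2) (by norm_num) (s := 2)
        (by norm_num)).const_mul (1 / 2)
      refine this.congr (Filter.Eventually.of_forall fun x => ?_)
      simp
      ring
    refine hdom.mono' ?_ ?_
    · exact Measurable.aestronglyMeasurable (by unfold Function.uncurry; fun_prop)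
    · have hae : ∀ᵐ z ∂((volume : Measure ℝ).prod (volume.restrict (Set.Ioi (0 : ℝ)))),
          0 < z.2 := by
        have : ∀ᵐ t ∂(volume.restrict (Set.Ioi (0 : ℝ))), 0 < t :=
          (ae_restrict_iff' measurableSet_Ioi).2 (Filter.Eventually.of_forall fun t ht => ht)
        exact Measure.quasiMeasurePreserving_snd.ae this
      filter_upwards [hae] with z hz
      simp only [Function.uncurry]
      rw [norm_mul, Real.norm_eq_abs, Real.norm_eq_abs, Real.abs_exp, mul_right_comm]
      gcongr
      have := abs_one_sub_cos_le (z.2 * z.1)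
      refine abs_div_sq_le hz this.1 ?_
      rw [mul_pow] at this
      linarith [this.2]

/-! ### Averages over the circle -/

/-- The average of a function over the unit circle. -/
noncomputable def circAvg {E : Type*} [NormedAddCommGroup E] [NormedSpace ℝ E] (G : ℂ → E) : E :=
  ∫ θ : UnitAddCircle, G (AddCircle.toCircle θ) ∂AddCircle.haarAddCircle

theorem exists_toCircle_eq (c : Circle) : ∃ τ : UnitAddCircle, AddCircle.toCircle τ = c := by
  refine ⟨((Complex.arg c / (2 * Real.pi) : ℝ) : UnitAddCircle), ?_⟩
  rw [AddCircle.toCircle_apply_mk]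
  have : 2 * Real.pi / 1 * (Complex.arg c / (2 * Real.pi)) = Complex.arg c := by
    have := Real.pi_ne_zero
    field_simp
  rw [this, Circle.exp_arg]

theorem continuous_coe_toCircle :
    Continuous fun θ : UnitAddCircle => (AddCircle.toCircle θ : ℂ) :=
  continuous_subtype_val.comp AddCircle.continuous_toCircle

theorem integrable_circle {E : Type*} [NormedAddCommGroup E] {G : UnitAddCircle → E}
    (hG : Continuous G) : Integrable G AddCircle.haarAddCircle :=
  hG.integrable_of_hasCompactSupport (HasCompactSupport.of_compactSpace G)

section

variable {E : Type*} [NormedAddCommGroup E] [NormedSpace ℝ E]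

theorem circAvg_rotate (G : ℂ → E) (c : Circle) : circAvg (fun z => G (c * z)) = circAvg G := by
  obtain ⟨τ, rfl⟩ := exists_toCircle_eq c
  unfold circAvg
  rw [← integral_add_left_eq_self (fun θ : UnitAddCircle => G (AddCircle.toCircle θ)) τ]
  simp [AddCircle.toCircle_add]

theorem circAvg_eq_integral (G : ℂ → E) : circAvg G =
    (2 * Real.pi)⁻¹ • ∫ t in (0)..(2 * Real.pi), G (Complex.exp (t * Complex.I)) := by
  unfold circAvg
  rw [AddCircle.integral_haarAddCircle, inv_one, one_smul,
    ← UnitAddCircle.intervalIntegral_preimage 0]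
  simp_rw [AddCircle.toCircle_apply_mk, Circle.coe_exp, div_one, zero_add]
  rw [intervalIntegral.integral_comp_mul_left (fun t : ℝ => G (Complex.exp (t * Complex.I)))
    (by positivity), mul_zero, mul_one]

theorem circAvg_const [CompleteSpace E] (c : E) : circAvg (fun _ => c) = c := by
  simp [circAvg]

end

theorem circAvg_sub {E : Type*} [NormedAddCommGroup E] [NormedSpace ℝ E] {F G : ℂ → E}
    (hF : Continuous F) (hG : Continuous G) :
    circAvg (fun z => F z - G z) = circAvg F - circAvg G :=
  integral_sub (integrable_circle (hF.comp continuous_coe_toCircle))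
    (integrable_circle (hG.comp continuous_coe_toCircle))

theorem circAvg_mul_const (F : ℂ → ℝ) (c : ℝ) :
    circAvg (fun z => F z * c) = circAvg F * c :=
  integral_mul_const _ _

theorem circAvg_mono {F G : ℂ → ℝ} (hF : Continuous F) (hG : Continuous G)
    (h : ∀ z, ‖z‖ = 1 → F z ≤ G z) : circAvg F ≤ circAvg G :=
  integral_mono (integrable_circle (hF.comp continuous_coe_toCircle))
    (integrable_circle (hG.comp continuous_coe_toCircle)) fun _ => h _ (Circle.norm_coe _)

theorem besselJ0_eq_circAvg (x : ℝ) : besselJ0 x = circAvg fun z => Real.cos (x * z.re) := by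
  rw [circAvg_eq_integral]
  simp [besselJ0, periodAvg, Complex.exp_ofReal_mul_I_re]

theorem exists_circle_mul_norm (w : ℂ) : ∃ c : Circle, w = ‖w‖ * c := by
  refine ⟨Circle.exp (Complex.arg w), ?_⟩
  rw [Circle.coe_exp, Complex.norm_mul_exp_arg_mul_I]

theorem circAvg_cos (w : ℂ) : circAvg (fun z => Real.cos (w * z).re) = besselJ0 ‖w‖ := by
  obtain ⟨c, hc⟩ := exists_circle_mul_norm w
  rw [besselJ0_eq_circAvg, ← circAvg_rotate (fun z => Real.cos (‖w‖ * z.re)) c]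
  congr 1
  funext z
  conv_lhs => rw [hc]
  rw [mul_assoc, Complex.re_ofReal_mul]

theorem circAvg_sin (w : ℂ) : circAvg (fun z => Real.sin (w * z).re) = 0 := by
  have h := circAvg_rotate (fun z => Real.sin (w * z).re) (-1)
  have h2 : circAvg (fun z => Real.sin (w * (((-1 : Circle) : ℂ) * z)).re) =
      -circAvg (fun z => Real.sin (w * z).re) := by
    have h3 : ∀ z : ℂ, Real.sin (w * (((-1 : Circle) : ℂ) * z)).re = -Real.sin (w * z).re := by
      intro z
      rw [← Real.sin_neg, ← Complex.neg_re]
      congr 2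
      simp
    simp_rw [h3]
    exact integral_neg _
  rw [h2] at h
  linarith

/-- Averaging over one rotation turns `J₀` of a sum into a product. -/
theorem circAvg_besselJ0_norm_add (w v : ℂ) :
    circAvg (fun z => besselJ0 ‖w * z + v‖) = besselJ0 ‖w‖ * besselJ0 ‖v‖ := by
  have h1 : ∀ u : ℂ, circAvg (fun z => Real.cos ((w * z).re + (u).re)) =
      besselJ0 ‖w‖ * Real.cos u.re := by
    intro u
    simp_rw [Real.cos_add]
    have hc : Continuous fun z : ℂ => Real.cos (w * z).re * Real.cos u.re := by fun_prop
    have hs : Continuous fun z : ℂ => Real.sin (w * z).re * Real.sin u.re := by fun_prop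
    rw [circAvg_sub hc hs, circAvg_mul_const, circAvg_mul_const, circAvg_cos, circAvg_sin]
    ring
  have h2 : ∀ c : Circle, circAvg (fun z => Real.cos ((w * z + v) * c).re) =
      besselJ0 ‖w‖ * Real.cos (v * c).re := by
    intro c
    rw [← h1, ← circAvg_rotate (fun z => Real.cos ((w * z).re + (v * c).re)) c]
    congr 1
    funext z
    rw [← Complex.add_re]
    congr 2
    ring
  simp_rw [← circAvg_cos (_ * _ + v)]
  have hcont : Continuous fun p : UnitAddCircle × UnitAddCircle =>
      Real.cos ((w * (AddCircle.toCircle p.1 : ℂ) + v) * (AddCircle.toCircle p.2 : ℂ)).re := by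
    have h1 := continuous_coe_toCircle.comp (continuous_fst (X := UnitAddCircle)
      (Y := UnitAddCircle))
    have h2 := continuous_coe_toCircle.comp (continuous_snd (X := UnitAddCircle)
      (Y := UnitAddCircle))
    simp only [Function.comp_def] at h1 h2
    fun_prop
  have hswap := integral_integral_swap
    (f := fun (θ τ : UnitAddCircle) =>
      Real.cos ((w * (AddCircle.toCircle θ : ℂ) + v) * (AddCircle.toCircle τ : ℂ)).re)
    (μ := AddCircle.haarAddCircle) (ν := AddCircle.haarAddCircle)
    (hcont.integrable_of_hasCompactSupport (HasCompactSupport.of_compactSpace _))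
  unfold circAvg at h2 ⊢
  rw [hswap]
  simp_rw [h2]
  rw [integral_const_mul]
  congr 1
  exact circAvg_cos v

theorem integral_abs_cos_zero_pi : ∫ t in (0)..Real.pi, |Real.cos t| = 2 := by
  have hc : Continuous fun t => |Real.cos t| := by fun_prop
  have hpi := Real.pi_pos
  have h1 : ∫ t in (0)..(Real.pi / 2), |Real.cos t| = 1 := by
    rw [intervalIntegral.integral_congr (g := Real.cos)]
    · simp
    · intro t ht
      rw [Set.uIcc_of_le (by linarith)] at ht
      exact abs_of_nonneg (Real.cos_nonneg_of_mem_Icc ⟨by linarith [ht.1], ht.2⟩)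
  have h2 : ∫ t in (Real.pi / 2)..Real.pi, |Real.cos t| = 1 := by
    rw [intervalIntegral.integral_congr (g := fun t => -Real.cos t)]
    · rw [intervalIntegral.integral_neg]
      simp
    · intro t ht
      rw [Set.uIcc_of_le (by linarith)] at ht
      exact abs_of_nonpos (Real.cos_nonpos_of_pi_div_two_le_of_le ht.1 (by linarith [ht.2]))
  rw [← intervalIntegral.integral_add_adjacent_intervals (b := Real.pi / 2)
    (hc.intervalIntegrable _ _) (hc.intervalIntegrable _ _), h1, h2]
  norm_num

theorem periodAvg_abs_cos : periodAvg (fun t => |Real.cos t|) = 2 / Real.pi := by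
  have hper : Function.Periodic (fun t => |Real.cos t|) Real.pi := fun t => by
    simp [Real.cos_add_pi]
  have hc : Continuous fun t => |Real.cos t| := by fun_prop
  have hpi := Real.pi_pos
  have h := hper.intervalIntegral_add_eq Real.pi 0
  rw [zero_add, integral_abs_cos_zero_pi] at h
  unfold periodAvg
  rw [two_mul, ← intervalIntegral.integral_add_adjacent_intervals (b := Real.pi)
    (hc.intervalIntegrable _ _) (hc.intervalIntegrable _ _), integral_abs_cos_zero_pi, h]
  field_simp

theorem circAvg_abs_re : circAvg (fun z => |z.re|) = 2 / Real.pi := by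
  rw [← periodAvg_abs_cos, circAvg_eq_integral]
  simp [periodAvg, Complex.exp_ofReal_mul_I_re]

/-- `|1 + e^{it}| = 2 |cos (t / 2)|` has average `4 / π`. -/
theorem circAvg_norm_add_one : circAvg (fun z => ‖z + 1‖) = 4 / Real.pi := by
  have h : ∀ t : ℝ, ‖Complex.exp (t * Complex.I) + 1‖ = 2 * |Real.cos (2⁻¹ * t)| := by
    intro t
    have h1 : Complex.exp (t * Complex.I) + 1 =
        Complex.exp (((2⁻¹ * t : ℝ) : ℂ) * Complex.I) * (2 * (Real.cos (2⁻¹ * t) : ℂ)) := by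
      rw [Complex.ofReal_cos, Complex.two_cos, mul_add, ← Complex.exp_add, ← Complex.exp_add]
      push_cast
      ring_nf
      rw [Complex.exp_zero, add_comm]
    rw [h1, norm_mul, Complex.norm_exp_ofReal_mul_I, one_mul, norm_mul, Complex.norm_real]
    simp
  rw [circAvg_eq_integral]
  simp_rw [h]
  rw [intervalIntegral.integral_const_mul,
    intervalIntegral.integral_comp_mul_left (fun t => |Real.cos t|) (by norm_num), mul_zero,
    inv_mul_cancel_left₀ (by norm_num), integral_abs_cos_zero_pi]
  simp
  field_simp
  norm_num

theorem one_sub_besselJ0_bounds (t : ℝ) :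
    |1 - besselJ0 t| ≤ 2 ∧ |1 - besselJ0 t| ≤ t ^ 2 / 4 := by
  have h1 := abs_le.1 (abs_besselJ0_le_one t)
  have h2 := besselJ0_ge t
  rw [abs_of_nonneg (by linarith)]
  exact ⟨by linarith, by linarith⟩

/-- The modulus as a superposition of Bessel functions. -/
theorem integral_one_sub_besselJ0_div_sq {r : ℝ} (hr : 0 ≤ r) :
    ∫ t in Set.Ioi (0 : ℝ), (1 - besselJ0 (r * t)) / t ^ 2 = r := by
  have hJ : ∀ t : ℝ, (1 - besselJ0 (r * t)) / t ^ 2 =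
      ∫ θ : UnitAddCircle, (1 - Real.cos (t * (r * (AddCircle.toCircle θ : ℂ).re))) / t ^ 2
        ∂AddCircle.haarAddCircle := by
    intro t
    have hc : Continuous fun θ : UnitAddCircle =>
        Real.cos (t * (r * (AddCircle.toCircle θ : ℂ).re)) := by
      have := continuous_coe_toCircle
      fun_prop
    rw [integral_div, integral_sub (integrable_const _) (integrable_circle hc),
      besselJ0_eq_circAvg, circAvg]
    simp only [integral_const, probReal_univ, one_smul]
    congr 3
    funext θ
    ring_nf
  have hm : Measurable fun θ : UnitAddCircle => (AddCircle.toCircle θ : ℂ) :=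
    continuous_coe_toCircle.measurable
  simp_rw [hJ]
  rw [integral_integral_swap]
  · simp_rw [integral_one_sub_cos_mul_div_sq, integral_one_sub_cos_div_sq, abs_mul]
    rw [integral_mul_const, integral_const_mul]
    have h := circAvg_abs_re
    unfold circAvg at h
    rw [h, abs_of_nonneg hr]
    have := Real.pi_ne_zero
    field_simp
  · have hdom : Integrable (fun z : ℝ × UnitAddCircle => ((2 + r ^ 2) * (1 + z.1 ^ 2)⁻¹) * 1)
        ((volume.restrict (Set.Ioi (0 : ℝ))).prod AddCircle.haarAddCircle) :=
      Integrable.mul_prod (f := fun t : ℝ => (2 + r ^ 2) * (1 + t ^ 2)⁻¹)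
        (g := fun _ : UnitAddCircle => (1 : ℝ)) ((integrable_inv_one_add_sq.const_mul _).restrict)
        (integrable_const _)
    refine hdom.mono' ?_ ?_
    · exact Measurable.aestronglyMeasurable (by unfold Function.uncurry; fun_prop)
    · have hae : ∀ᵐ z ∂((volume.restrict (Set.Ioi (0 : ℝ))).prod
          (AddCircle.haarAddCircle (T := 1))), 0 < z.1 := by
        have : ∀ᵐ t ∂(volume.restrict (Set.Ioi (0 : ℝ))), 0 < t :=
          (ae_restrict_iff' measurableSet_Ioi).2 (Filter.Eventually.of_forall fun t ht => ht)
        exact Measure.quasiMeasurePreserving_fst.ae this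
      filter_upwards [hae] with z hz
      simp only [Function.uncurry, mul_one]
      have := abs_one_sub_cos_le (z.1 * (r * (AddCircle.toCircle z.2 : ℂ).re))
      refine abs_div_sq_le hz this.1 (this.2.trans ?_)
      have h2 : (AddCircle.toCircle z.2 : ℂ).re ^ 2 ≤ 1 := by
        rw [← sq_abs]
        refine pow_le_one₀ (abs_nonneg _) ((Complex.abs_re_le_norm _).trans ?_)
        rw [Circle.norm_coe]
      rw [mul_pow, mul_pow]
      have h3 : r ^ 2 * (AddCircle.toCircle z.2 : ℂ).re ^ 2 ≤ r ^ 2 :=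
        mul_le_of_le_one_right (sq_nonneg _) h2
      nlinarith [mul_le_mul_of_nonneg_left h3 (sq_nonneg z.1), mul_nonneg (sq_nonneg r)
        (sq_nonneg z.1)]

/-- The first absolute moment of a bounded random variable in terms of its Bessel transform. -/
theorem integral_norm_eq_integral_besselJ0 {Ω : Type*} [MeasurableSpace Ω] (μ : Measure Ω)
    [IsProbabilityMeasure μ] {X : Ω → ℂ} (hX : Measurable X) {R : ℝ} (hR : ∀ ω, ‖X ω‖ ≤ R) :
    ∫ ω, ‖X ω‖ ∂μ =
      ∫ t in Set.Ioi (0 : ℝ), (1 - ∫ ω, besselJ0 (‖X ω‖ * t) ∂μ) / t ^ 2 := by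
  have hJm : Measurable besselJ0 := continuous_besselJ0.measurable
  have hI : ∀ t : ℝ, Integrable (fun ω => besselJ0 (‖X ω‖ * t)) μ := fun t =>
    (integrable_const (1 : ℝ)).mono' (hJm.comp (hX.norm.mul_const t)).aestronglyMeasurable
      (Filter.Eventually.of_forall fun ω => abs_besselJ0_le_one _)
  have h1 : ∀ t : ℝ, (1 - ∫ ω, besselJ0 (‖X ω‖ * t) ∂μ) / t ^ 2 =
      ∫ ω, (1 - besselJ0 (‖X ω‖ * t)) / t ^ 2 ∂μ := by
    intro t
    rw [integral_div, integral_sub (integrable_const _) (hI t)]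
    simp
  simp_rw [h1]
  rw [← integral_integral_swap]
  · simp_rw [integral_one_sub_besselJ0_div_sq (norm_nonneg _)]
  · have hdom : Integrable (fun z : Ω × ℝ => 1 * ((2 + R ^ 2) * (1 + z.2 ^ 2)⁻¹))
        (μ.prod (volume.restrict (Set.Ioi (0 : ℝ)))) :=
      Integrable.mul_prod (f := fun _ : Ω => (1 : ℝ))
        (g := fun t : ℝ => (2 + R ^ 2) * (1 + t ^ 2)⁻¹) (integrable_const _)
        ((integrable_inv_one_add_sq.const_mul _).restrict)
    refine hdom.mono' ?_ ?_
    · exact Measurable.aestronglyMeasurable (by unfold Function.uncurry; fun_prop)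
    · have hae : ∀ᵐ z ∂(μ.prod (volume.restrict (Set.Ioi (0 : ℝ)))), 0 < z.2 := by
        have : ∀ᵐ t ∂(volume.restrict (Set.Ioi (0 : ℝ))), 0 < t :=
          (ae_restrict_iff' measurableSet_Ioi).2 (Filter.Eventually.of_forall fun t ht => ht)
        exact Measure.quasiMeasurePreserving_snd.ae this
      filter_upwards [hae] with z hz
      simp only [Function.uncurry, one_mul]
      have := one_sub_besselJ0_bounds (‖X z.1‖ * z.2)
      refine abs_div_sq_le hz this.1 (this.2.trans ?_)
      have h2 : ‖X z.1‖ ^ 2 ≤ R ^ 2 := pow_le_pow_left₀ (norm_nonneg _) (hR _) 2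
      rw [mul_pow]
      nlinarith [mul_le_mul_of_nonneg_right h2 (sq_nonneg z.2), mul_nonneg (sq_nonneg R)
        (sq_nonneg z.2)]

theorem integral_one_sub_besselJ0_sq_div_sq :
    ∫ t in Set.Ioi (0 : ℝ), (1 - besselJ0 t ^ 2) / t ^ 2 = 4 / Real.pi := by
  have h := integral_norm_eq_integral_besselJ0 (AddCircle.haarAddCircle (T := 1))
    (X := fun θ => (AddCircle.toCircle θ : ℂ) + 1) (R := 2)
    (continuous_coe_toCircle.measurable.add_const _) ?_
  · have h0 := circAvg_norm_add_one
    unfold circAvg at h0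
    rw [← h0, h]
    refine setIntegral_congr_fun measurableSet_Ioi fun t (ht : 0 < t) => ?_
    have h1 := circAvg_besselJ0_norm_add t t
    rw [Complex.norm_real, Real.norm_of_nonneg ht.le, ← sq] at h1
    rw [← h1]
    unfold circAvg
    congr 3
    funext θ
    beta_reduce
    rw [← mul_add_one, norm_mul, Complex.norm_real, Real.norm_of_nonneg ht.le, mul_comm]
  · intro θ
    refine (norm_add_le _ _).trans ?_
    rw [Circle.norm_coe]
    norm_num

/-! ### Moments over one rotation -/

theorem circAvg_re_mul (c : ℂ) : circAvg (fun z => (c * z).re) = 0 := by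
  have h := circAvg_rotate (fun z => (c * z).re) (-1)
  have h2 : circAvg (fun z => (c * (((-1 : Circle) : ℂ) * z)).re) =
      -circAvg (fun z => (c * z).re) := by
    have h3 : ∀ z : ℂ, (c * (((-1 : Circle) : ℂ) * z)).re = -(c * z).re := by
      intro z
      rw [← Complex.neg_re]
      congr 1
      simp
    simp_rw [h3]
    exact integral_neg _
  rw [h2] at h
  linarith

theorem circAvg_re_mul_sq (c : ℂ) : circAvg (fun z => (c * z).re ^ 2) = ‖c‖ ^ 2 / 2 := by
  obtain ⟨d, hd⟩ := exists_circle_mul_norm c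
  have h1 : circAvg (fun z => (c * z).re ^ 2) = circAvg (fun z => (‖c‖ * z.re) ^ 2) := by
    rw [← circAvg_rotate (fun z => (‖c‖ * z.re) ^ 2) d]
    congr 1
    funext z
    conv_lhs => rw [hd]
    rw [mul_assoc, Complex.re_ofReal_mul]
  have h2 := cosMoment_succ 0
  rw [cosMoment_zero] at h2
  rw [h1, circAvg_eq_integral]
  simp only [Complex.exp_ofReal_mul_I_re, mul_pow]
  rw [intervalIntegral.integral_const_mul, smul_eq_mul, mul_left_comm]
  unfold cosMoment periodAvg at h2
  norm_num at h2 ⊢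
  rw [h2]
  ring

theorem norm_mul_add_sq {z : ℂ} (hz : ‖z‖ = 1) (b v : ℂ) : ‖b * z + v‖ ^ 2 =
    (‖b‖ ^ 2 + ‖v‖ ^ 2) + 2 * (b * (starRingEnd ℂ) v * z).re := by
  rw [Complex.sq_norm, Complex.normSq_add, ← Complex.sq_norm, ← Complex.sq_norm, norm_mul, hz,
    mul_one]
  congr 3
  ring

theorem circAvg_congr {E : Type*} [NormedAddCommGroup E] [NormedSpace ℝ E] {F G : ℂ → E}
    (h : ∀ z, ‖z‖ = 1 → F z = G z) : circAvg F = circAvg G :=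
  integral_congr_ae (Filter.Eventually.of_forall fun _ => h _ (Circle.norm_coe _))

theorem circAvg_add {E : Type*} [NormedAddCommGroup E] [NormedSpace ℝ E] {F G : ℂ → E}
    (hF : Continuous F) (hG : Continuous G) :
    circAvg (fun z => F z + G z) = circAvg F + circAvg G :=
  integral_add (integrable_circle (hF.comp continuous_coe_toCircle))
    (integrable_circle (hG.comp continuous_coe_toCircle))

theorem circAvg_const_mul (c : ℝ) (F : ℂ → ℝ) :
    circAvg (fun z => c * F z) = c * circAvg F :=
  integral_const_mul _ _

theorem circAvg_norm_sq (b v : ℂ) :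
    circAvg (fun z => ‖b * z + v‖ ^ 2) = ‖b‖ ^ 2 + ‖v‖ ^ 2 := by
  rw [circAvg_congr fun z hz => norm_mul_add_sq hz b v, circAvg_add (by fun_prop) (by fun_prop),
    circAvg_const, circAvg_const_mul, circAvg_re_mul]
  ring

theorem circAvg_norm_pow_four (b v : ℂ) :
    circAvg (fun z => ‖b * z + v‖ ^ 4) = ‖b‖ ^ 4 + 4 * ‖b‖ ^ 2 * ‖v‖ ^ 2 + ‖v‖ ^ 4 := by
  have h : ∀ z : ℂ, ‖z‖ = 1 → ‖b * z + v‖ ^ 4 = ((‖b‖ ^ 2 + ‖v‖ ^ 2) ^ 2 +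
      4 * (‖b‖ ^ 2 + ‖v‖ ^ 2) * (b * (starRingEnd ℂ) v * z).re) +
      4 * (b * (starRingEnd ℂ) v * z).re ^ 2 := by
    intro z hz
    rw [show ‖b * z + v‖ ^ 4 = (‖b * z + v‖ ^ 2) ^ 2 by ring, norm_mul_add_sq hz]
    ring
  rw [circAvg_congr h, circAvg_add (by fun_prop) (by fun_prop),
    circAvg_add (by fun_prop) (by fun_prop), circAvg_const, circAvg_const_mul, circAvg_const_mul,
    circAvg_re_mul, circAvg_re_mul_sq, norm_mul, RCLike.norm_conj]
  ring

theorem circAvg_inv_one_add {c : ℂ} (hc : ‖c‖ < 1) : circAvg (fun z => (1 + c * z)⁻¹) = 1 := by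
  have hne : ∀ z ∈ Metric.closedBall (0 : ℂ) |1|, 1 + c * z ≠ 0 := by
    intro z hz h0
    rw [abs_one, mem_closedBall_zero_iff] at hz
    have h1 : c * z = -1 := by linear_combination h0
    have h2 : ‖c‖ * ‖z‖ = 1 := by rw [← norm_mul, h1]; simp
    nlinarith [norm_nonneg c, norm_nonneg z]
  have hd : DifferentiableOn ℂ (fun z => (1 + c * z)⁻¹) (Metric.closedBall 0 |1|) := by
    intro z hz
    have := hne z hz
    fun_prop (disch := assumption)
  have h := (hd.diffContOnCl_ball subset_rfl).circleAverage
  rw [mul_zero, add_zero, inv_one] at h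
  refine Eq.trans ?_ h
  rw [circAvg_eq_integral, Real.circleAverage]
  simp [circleMap]

/-- For `‖w‖ < 2`, the first two terms of the expansion of the average of `‖z + w‖` in powers of
`‖w‖²`. With `c = conj w / 2`, the modulus `‖z + w‖ = ‖1 + 2 c z‖` is at least the real part of its
product with the unimodular function `conj (1 + c z) / (1 + c z)`, whose average is explicit. -/
theorem circAvg_norm_add_ge_of_lt {w : ℂ} (hw : ‖w‖ < 2) :
    1 + ‖w‖ ^ 2 / 4 ≤ circAvg (fun z => ‖z + w‖) := by
  set c := (starRingEnd ℂ) w / 2 with hcdef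
  have hc : ‖c‖ < 1 := by
    rw [hcdef, norm_div, RCLike.norm_conj, RCLike.norm_ofNat]
    linarith
  have hne : ∀ z : ℂ, ‖z‖ = 1 → 1 + c * z ≠ 0 := by
    intro z hz h0
    have h1 : c * z = -1 := by linear_combination h0
    have h2 : ‖c‖ * ‖z‖ = 1 := by rw [← norm_mul, h1]; simp
    rw [hz] at h2
    linarith
  have hcw : ‖c‖ ^ 2 = ‖w‖ ^ 2 / 4 := by
    rw [hcdef, norm_div, RCLike.norm_conj, RCLike.norm_ofNat]
    ring
  have hpt : ∀ z : ℂ, ‖z‖ = 1 →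
      2 + (c * z).re + (‖c‖ ^ 2 - 1) * ((1 + c * z)⁻¹).re ≤ ‖z + w‖ := by
    intro z hz
    have hzz : (starRingEnd ℂ) z * z = 1 := by
      rw [mul_comm, Complex.mul_conj, Complex.normSq_eq_norm_sq, hz]; simp
    have h1 : ‖z + w‖ = ‖(1 + 2 * c * z) * ((starRingEnd ℂ) (1 + c * z) / (1 + c * z))‖ := by
      rw [norm_mul, norm_div, RCLike.norm_conj, div_self (norm_ne_zero_iff.2 (hne z hz)), mul_one,
        ← RCLike.norm_conj (z + w), ← mul_one ‖(starRingEnd ℂ) (z + w)‖, ← hz, ← norm_mul, map_add,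
        add_mul, hzz, hcdef]
      congr 2
      ring
    rw [h1]
    refine le_trans (le_of_eq ?_) (Complex.re_le_norm _)
    have hcc : (starRingEnd ℂ) c * c = ((‖c‖ ^ 2 : ℝ) : ℂ) := by
      rw [mul_comm, Complex.mul_conj, Complex.normSq_eq_norm_sq]
    have h2 : (1 + 2 * c * z) * ((starRingEnd ℂ) (1 + c * z) / (1 + c * z)) =
        2 + (starRingEnd ℂ) (c * z) + ((‖c‖ ^ 2 - 1 : ℝ) : ℂ) * (1 + c * z)⁻¹ := by
      have := hne z hz
      have hinv := inv_mul_cancel₀ this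
      rw [← mul_div_assoc, div_eq_iff this, map_add, map_mul, map_one, Complex.ofReal_sub, ← hcc,
        Complex.ofReal_one]
      linear_combination ((starRingEnd ℂ) c * c) * hzz - ((starRingEnd ℂ) c * c - 1) * hinv
    rw [h2, Complex.add_re, Complex.add_re, Complex.conj_re, Complex.re_ofReal_mul]
    simp
  have hcont : Continuous fun θ : UnitAddCircle => (1 + c * (AddCircle.toCircle θ : ℂ))⁻¹ := by
    refine Continuous.inv₀ ?_ fun θ => hne _ (Circle.norm_coe _)
    exact continuous_const.add (continuous_const.mul continuous_coe_toCircle)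
  have hI1 : Integrable (fun θ : UnitAddCircle => 2 + (c * (AddCircle.toCircle θ : ℂ)).re)
      AddCircle.haarAddCircle := by
    refine integrable_circle ?_
    exact continuous_const.add (Complex.continuous_re.comp
      (continuous_const.mul continuous_coe_toCircle))
  have hI2 : Integrable (fun θ : UnitAddCircle => ((1 + c * (AddCircle.toCircle θ : ℂ))⁻¹).re)
      AddCircle.haarAddCircle := integrable_circle (Complex.continuous_re.comp hcont)
  have hinv : circAvg (fun z => ((1 + c * z)⁻¹).re) = 1 := by
    have h := circAvg_inv_one_add hc
    have h2 := integral_re (integrable_circle hcont)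
    unfold circAvg at h ⊢
    simp only [RCLike.re_to_complex] at h2
    rw [h2, h, Complex.one_re]
  have hlin : circAvg (fun z => 2 + (c * z).re) = 2 := by
    rw [circAvg_add (by fun_prop) (by fun_prop), circAvg_const, circAvg_re_mul, add_zero]
  calc 1 + ‖w‖ ^ 2 / 4
      = circAvg (fun z => 2 + (c * z).re) +
          (‖c‖ ^ 2 - 1) * circAvg (fun z => ((1 + c * z)⁻¹).re) := by
        rw [hlin, hinv, hcw]; ring
    _ = circAvg (fun z => 2 + (c * z).re + (‖c‖ ^ 2 - 1) * ((1 + c * z)⁻¹).re) := by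
        rw [← circAvg_const_mul]
        exact (integral_add hI1 (hI2.const_mul _)).symm
    _ ≤ circAvg (fun z => ‖z + w‖) := by
        refine integral_mono (hI1.add (hI2.const_mul _)) (integrable_circle ?_)
          fun θ => hpt _ (Circle.norm_coe _)
        exact (continuous_coe_toCircle.add continuous_const).norm

theorem norm_le_circAvg_norm_add (w : ℂ) : ‖w‖ ≤ circAvg (fun z => ‖z + w‖) := by
  rcases eq_or_ne w 0 with rfl | hw
  · rw [norm_zero]
    exact integral_nonneg fun _ => norm_nonneg _
  · have hw' : 0 < ‖w‖ := norm_pos_iff.2 hw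
    have h : circAvg (fun z => ‖w‖ + ((starRingEnd ℂ) w / ‖w‖ * z).re) = ‖w‖ := by
      rw [circAvg_add (by fun_prop) (by fun_prop), circAvg_const, circAvg_re_mul, add_zero]
    rw [← h]
    refine circAvg_mono (by fun_prop) (by fun_prop) fun z hz => ?_
    have h1 : ‖z + w‖ = ‖(starRingEnd ℂ) w / ‖w‖ * (z + w)‖ := by
      rw [norm_mul, norm_div, RCLike.norm_conj, Complex.norm_real, norm_norm, div_self hw'.ne',
        one_mul]
    rw [h1]
    refine le_trans (le_of_eq ?_) (Complex.re_le_norm _)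
    rw [mul_add, Complex.add_re, add_comm]
    congr 1
    rw [div_mul_eq_mul_div, mul_comm, Complex.mul_conj, Complex.normSq_eq_norm_sq,
      ← Complex.ofReal_div, Complex.ofReal_re]
    field_simp

/-- The correction term makes the bound `1 + ‖w‖² / 4` valid for all `w`. -/
theorem circAvg_norm_add_ge (w : ℂ) :
    1 + ‖w‖ ^ 2 / 4 - ‖w‖ ^ 4 / 256 ≤ circAvg (fun z => ‖z + w‖) := by
  rcases lt_or_ge ‖w‖ 2 with h | h
  · have := circAvg_norm_add_ge_of_lt h
    have : 0 ≤ ‖w‖ ^ 4 := by positivity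
    linarith
  · refine le_trans ?_ (norm_le_circAvg_norm_add w)
    nlinarith [mul_nonneg (sq_nonneg (‖w‖ - 4)) (show 0 ≤ ‖w‖ ^ 2 + 8 * ‖w‖ - 16 by nlinarith)]

theorem circAvg_norm_mul_add_ge {b : ℂ} (hb : b ≠ 0) (v : ℂ) :
    ‖b‖ * (1 + ‖v‖ ^ 2 / ‖b‖ ^ 2 / 4 - ‖v‖ ^ 4 / ‖b‖ ^ 4 / 256) ≤
      circAvg (fun z => ‖b * z + v‖) := by
  have h : ∀ z : ℂ, ‖b * z + v‖ = ‖b‖ * ‖z + v / b‖ := by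
    intro z
    rw [← norm_mul, mul_add, mul_div_cancel₀ _ hb]
  simp_rw [h]
  rw [circAvg_const_mul]
  have := circAvg_norm_add_ge (v / b)
  rw [norm_div, div_pow, div_pow] at this
  gcongr

/-! ### Sums of independent rotations -/

/-- The random variable `∑_{j ∈ S} b_j z_j` on the polytorus. -/
noncomputable def steinhausSum (b : ℕ → ℂ) (S : Finset ℕ) (ω : Polytorus) : ℂ :=
  ∑ j ∈ S, b j * (AddCircle.toCircle (ω j) : ℂ)

theorem continuous_steinhausSum (b : ℕ → ℂ) (S : Finset ℕ) : Continuous (steinhausSum b S) :=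
  continuous_finsetSum _ fun j _ =>
    continuous_const.mul (continuous_coe_toCircle.comp (continuous_apply j))

theorem integrable_torus {E : Type*} [NormedAddCommGroup E] [SecondCountableTopology E]
    {G : Polytorus → E} (hG : Continuous G) : Integrable G polytorusMeasure := by
  obtain ⟨C, hC⟩ := isCompact_univ.exists_bound_of_continuousOn hG.continuousOn
  exact (integrable_const C).mono' hG.aestronglyMeasurable
    (Filter.Eventually.of_forall fun ω => by simpa using hC ω (Set.mem_univ _))

theorem norm_steinhausSum_le (b : ℕ → ℂ) (S : Finset ℕ) (ω : Polytorus) :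
    ‖steinhausSum b S ω‖ ≤ ∑ j ∈ S, ‖b j‖ := by
  refine (norm_sum_le _ _).trans (Finset.sum_le_sum fun j _ => ?_)
  rw [norm_mul, Circle.norm_coe, mul_one]

/-- The variables are independent: integrating over one of them first. -/
theorem integral_comp_steinhausSum_insert (b : ℕ → ℂ) {S : Finset ℕ} {i : ℕ} (hi : i ∉ S)
    {G : ℂ → ℝ} (hG : Continuous G) :
    ∫ ω, G (steinhausSum b (insert i S) ω) ∂polytorusMeasure =
      ∫ ω, circAvg (fun z => G (b i * z + steinhausSum b S ω)) ∂polytorusMeasure := by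
  set f : ℕ → Polytorus → ℂ := fun j ω => b j * (AddCircle.toCircle (ω j) : ℂ) with hf
  have hmeas : ∀ j, Measurable fun θ : UnitAddCircle => b j * (AddCircle.toCircle θ : ℂ) :=
    fun j => continuous_coe_toCircle.measurable.const_mul _
  have hind : ProbabilityTheory.iIndepFun f polytorusMeasure :=
    ProbabilityTheory.iIndepFun_infinitePi hmeas
  have hfm : ∀ j, Measurable (f j) := fun j => (hmeas j).comp (measurable_pi_apply j)
  have h2 := (hind.indepFun_finsetSum_of_notMem hfm hi).symm
  have hsum : (∑ j ∈ S, f j) = steinhausSum b S := by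
    funext ω
    simp [steinhausSum, hf]
  rw [hsum] at h2
  have hSm : Measurable (steinhausSum b S) := (continuous_steinhausSum b S).measurable
  rw [ProbabilityTheory.indepFun_iff_map_prod_eq_prod_map_map (hfm i).aemeasurable
    hSm.aemeasurable] at h2
  have hG2 : Continuous fun p : ℂ × ℂ => G (p.1 + p.2) := by fun_prop
  have e1 : ∫ ω, G (steinhausSum b (insert i S) ω) ∂polytorusMeasure =
      ∫ p, G (p.1 + p.2) ∂(polytorusMeasure.map fun ω => (f i ω, steinhausSum b S ω)) := by
    rw [integral_map ((hfm i).prodMk hSm).aemeasurable hG2.aestronglyMeasurable]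
    simp only [steinhausSum, Finset.sum_insert hi, hf]
  have hp1 : IsProbabilityMeasure (polytorusMeasure.map (f i)) :=
    Measure.isProbabilityMeasure_map (hfm i).aemeasurable
  have hp2 : IsProbabilityMeasure (polytorusMeasure.map (steinhausSum b S)) :=
    Measure.isProbabilityMeasure_map hSm.aemeasurable
  have hint : Integrable (fun p : ℂ × ℂ => G (p.1 + p.2))
      ((polytorusMeasure.map (f i)).prod (polytorusMeasure.map (steinhausSum b S))) := by
    rw [← h2, integrable_map_measure hG2.aestronglyMeasurable ((hfm i).prodMk hSm).aemeasurable]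
    refine integrable_torus (hG2.comp (Continuous.prodMk ?_ (continuous_steinhausSum b S)))
    exact continuous_const.mul (continuous_coe_toCircle.comp (continuous_apply i))
  rw [e1, h2, integral_prod_symm _ hint]
  refine (integral_map hSm.aemeasurable
    hint.swap.integral_prod_left.aestronglyMeasurable).trans ?_
  refine integral_congr_ae (Filter.Eventually.of_forall fun ω => ?_)
  have hmap : polytorusMeasure.map (f i) = (AddCircle.haarAddCircle (T := 1)).map
      fun θ => b i * (AddCircle.toCircle θ : ℂ) := by
    rw [← (measurePreserving_eval_infinitePi
      (fun _ : ℕ => (AddCircle.haarAddCircle : Measure UnitAddCircle)) i).map_eq,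
      Measure.map_map (hmeas i) (measurable_pi_apply i)]
    rfl
  simp only [hmap]
  rw [integral_map (hmeas i).aemeasurable (by fun_prop)]
  rfl

theorem integral_besselJ0_steinhausSum (b : ℕ → ℂ) (S : Finset ℕ) {t : ℝ} (ht : 0 < t) :
    ∫ ω, besselJ0 (‖steinhausSum b S ω‖ * t) ∂polytorusMeasure =
      ∏ j ∈ S, besselJ0 (‖b j‖ * t) := by
  induction S using Finset.induction_on with
  | empty => simp [steinhausSum, besselJ0_zero]
  | insert i S hi ih =>
    have hJ := continuous_besselJ0
    rw [integral_comp_steinhausSum_insert b hi (G := fun u => besselJ0 (‖u‖ * t)) (by fun_prop),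
      Finset.prod_insert hi, ← ih, ← integral_const_mul]
    refine integral_congr_ae (Filter.Eventually.of_forall fun ω => ?_)
    have hn : ∀ u : ℂ, ‖u‖ * t = ‖(t : ℂ) * u‖ := fun u => by
      rw [norm_mul, Complex.norm_real, Real.norm_of_nonneg ht.le, mul_comm]
    simp only [hn]
    rw [← circAvg_besselJ0_norm_add]
    congr 1
    funext z
    rw [mul_add, mul_assoc]

/-- The `L¹` norm of a linear form in the variables `z_j` as a Bessel integral. -/
theorem integral_norm_steinhausSum (b : ℕ → ℂ) (S : Finset ℕ) :
    ∫ ω, ‖steinhausSum b S ω‖ ∂polytorusMeasure =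
      ∫ t in Set.Ioi (0 : ℝ), (1 - ∏ j ∈ S, besselJ0 (‖b j‖ * t)) / t ^ 2 := by
  rw [integral_norm_eq_integral_besselJ0 polytorusMeasure
    (continuous_steinhausSum b S).measurable (norm_steinhausSum_le b S)]
  refine setIntegral_congr_fun measurableSet_Ioi fun t ht => ?_
  rw [integral_besselJ0_steinhausSum b S ht]

theorem integral_norm_sq_steinhausSum (b : ℕ → ℂ) (S : Finset ℕ) :
    ∫ ω, ‖steinhausSum b S ω‖ ^ 2 ∂polytorusMeasure = ∑ j ∈ S, ‖b j‖ ^ 2 := by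
  induction S using Finset.induction_on with
  | empty => simp [steinhausSum]
  | insert i S hi ih =>
    have hc := continuous_steinhausSum b S
    rw [integral_comp_steinhausSum_insert b hi (G := fun u => ‖u‖ ^ 2) (by fun_prop),
      Finset.sum_insert hi, ← ih]
    simp_rw [circAvg_norm_sq]
    rw [integral_add (integrable_const _) (integrable_torus (by fun_prop))]
    simp

theorem integral_norm_pow_four_steinhausSum_le (b : ℕ → ℂ) (S : Finset ℕ) :
    ∫ ω, ‖steinhausSum b S ω‖ ^ 4 ∂polytorusMeasure ≤ 2 * (∑ j ∈ S, ‖b j‖ ^ 2) ^ 2 := by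
  induction S using Finset.induction_on with
  | empty => simp [steinhausSum]
  | insert i S hi ih =>
    have hc := continuous_steinhausSum b S
    rw [integral_comp_steinhausSum_insert b hi (G := fun u => ‖u‖ ^ 4) (by fun_prop),
      Finset.sum_insert hi]
    simp_rw [circAvg_norm_pow_four]
    rw [integral_add (integrable_torus (by fun_prop)) (integrable_torus (by fun_prop)),
      integral_add (integrable_torus (by fun_prop)) (integrable_torus (by fun_prop)),
      integral_const_mul, integral_norm_sq_steinhausSum]
    simp
    nlinarith [sq_nonneg (‖b i‖ ^ 2)]

/-- A lower bound for the `L¹` norm that is effective when the coefficient `b i` dominates. -/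
theorem integral_norm_steinhausSum_insert_ge (b : ℕ → ℂ) {S : Finset ℕ} {i : ℕ} (hi : i ∉ S)
    (hb : b i ≠ 0) :
    ‖b i‖ * (1 + (∑ j ∈ S, ‖b j‖ ^ 2) / ‖b i‖ ^ 2 / 4 -
      ((∑ j ∈ S, ‖b j‖ ^ 2) / ‖b i‖ ^ 2) ^ 2 / 128) ≤
      ∫ ω, ‖steinhausSum b (insert i S) ω‖ ∂polytorusMeasure := by
  have hc := continuous_steinhausSum b S
  rw [integral_comp_steinhausSum_insert b hi (G := fun u => ‖u‖) (by fun_prop)]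
  have hbp : 0 < ‖b i‖ := norm_pos_iff.2 hb
  have hcirc : Continuous fun ω => circAvg (fun z => ‖b i * z + steinhausSum b S ω‖) := by
    unfold circAvg
    refine continuous_of_dominated (bound := fun _ => ‖b i‖ + ∑ j ∈ S, ‖b j‖) ?_ ?_
      (integrable_const _) ?_
    · exact fun ω => ((continuous_const.mul continuous_coe_toCircle).add
        continuous_const).norm.aestronglyMeasurable
    · refine fun ω => Filter.Eventually.of_forall fun θ => ?_
      rw [norm_norm]
      refine (norm_add_le _ _).trans (add_le_add (le_of_eq ?_) (norm_steinhausSum_le b S ω))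
      rw [norm_mul, Circle.norm_coe, mul_one]
    · exact Filter.Eventually.of_forall fun θ => by fun_prop
  refine le_trans ?_ (integral_mono (integrable_torus ?_) (integrable_torus hcirc)
    fun ω => circAvg_norm_mul_add_ge hb (steinhausSum b S ω))
  · rw [integral_const_mul, integral_sub (integrable_torus (by fun_prop))
      (integrable_torus (by fun_prop)), integral_add (integrable_torus (by fun_prop))
      (integrable_torus (by fun_prop)), integral_div, integral_div, integral_div, integral_div,
      integral_norm_sq_steinhausSum]
    refine mul_le_mul_of_nonneg_left ?_ hbp.le
    have h4 := integral_norm_pow_four_steinhausSum_le b S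
    have h5 : (∫ ω, ‖steinhausSum b S ω‖ ^ 4 ∂polytorusMeasure) / ‖b i‖ ^ 4 / 256 ≤
        (2 * (∑ j ∈ S, ‖b j‖ ^ 2) ^ 2) / ‖b i‖ ^ 4 / 256 := by gcongr
    have h6 : (2 * (∑ j ∈ S, ‖b j‖ ^ 2) ^ 2) / ‖b i‖ ^ 4 / 256 =
        ((∑ j ∈ S, ‖b j‖ ^ 2) / ‖b i‖ ^ 2) ^ 2 / 128 := by
      field_simp
      ring
    rw [h6] at h5
    simp
    linarith
  · fun_prop

/-! ### Powers of the Bessel function against Gaussians -/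

theorem exp_neg_bounds :
    107 / 250 ≤ Real.exp (-(46 / 25) ^ 2 / 4) ∧ Real.exp (-(46 / 25) ^ 2 / 4) ≤ 4291 / 10000 := by
  have hx : -(46 / 25 : ℝ) ^ 2 / 4 = -(529 / 625) := by norm_num
  have h1 := Real.exp_bound' (x := 529 / 625) (by norm_num) (by norm_num) (n := 7) (by norm_num)
  have h2 := Real.sum_le_exp_of_nonneg (x := 529 / 625) (by norm_num) 7
  simp only [Finset.sum_range_succ, Finset.sum_range_zero, Nat.factorial] at h1 h2
  norm_num at h1 h2
  rw [hx, Real.exp_neg]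
  constructor
  · rw [le_inv_comm₀ (by norm_num) (Real.exp_pos _)]
    linarith
  · rw [inv_le_comm₀ (Real.exp_pos _) (by norm_num)]
    linarith

/-- The slack between the Bessel and Gaussian integrals for the exponent `2`. -/
theorem exp_tail_le_slack :
    ∫ t in Set.Ioi (46 / 25 : ℝ), Real.exp (-t ^ 2 / 2) / t ^ 2 ≤
      4 / Real.pi - √(Real.pi * (1 / 2)) := by
  have h2 : √2 ≤ (46 / 25 : ℝ) := Real.sqrt_le_iff.2 (by norm_num)
  refine (integral_exp_div_sq_tail_le h2).trans ?_
  have h3 : Real.exp (-(46 / 25) ^ 2 / 2) ≤ (4291 / 10000) ^ 2 := by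
    rw [show -(46 / 25 : ℝ) ^ 2 / 2 = ((2 : ℕ) : ℝ) * (-(46 / 25) ^ 2 / 4) by norm_num,
      Real.exp_nat_mul]
    exact pow_le_pow_left₀ (Real.exp_pos _).le exp_neg_bounds.2 2
  have h4 : Real.exp (-(46 / 25) ^ 2 / 2) / ((46 / 25) ^ 3 + 2 * (46 / 25)) ≤ 187 / 10000 := by
    rw [div_le_iff₀ (by norm_num)]
    norm_num at h3 ⊢
    linarith
  have hp1 := Real.pi_lt_d4
  have hp2 := Real.pi_pos
  have h5 : √(Real.pi * (1 / 2)) ≤ 12534 / 10000 := Real.sqrt_le_iff.2 ⟨by norm_num, by linarith⟩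
  have h6 : 12732 / 10000 ≤ 4 / Real.pi := by
    rw [le_div_iff₀ hp2]
    linarith
  linarith

theorem one_sub_abs_besselJ0_rpow_bounds {s : ℝ} (hs : 2 ≤ s) (t : ℝ) :
    |1 - |besselJ0 t| ^ s| ≤ 1 ∧ |1 - |besselJ0 t| ^ s| ≤ s / 4 * t ^ 2 := by
  have h1 : |besselJ0 t| ^ s ≤ 1 :=
    Real.rpow_le_one (abs_nonneg _) (abs_besselJ0_le_one t) (by linarith)
  have h0 : 0 ≤ |besselJ0 t| ^ s := Real.rpow_nonneg (abs_nonneg _) _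
  rw [abs_of_nonneg (by linarith)]
  refine ⟨by linarith, ?_⟩
  rcases le_total (t ^ 2) 4 with h | h
  · have h2 := one_add_mul_self_le_rpow_one_add (s := -(t ^ 2 / 4)) (by linarith)
      (show (1 : ℝ) ≤ s by linarith)
    have h3 : (1 + -(t ^ 2 / 4)) ^ s ≤ |besselJ0 t| ^ s := by
      refine Real.rpow_le_rpow (by linarith) ?_ (by linarith)
      have := besselJ0_ge t
      have := le_abs_self (besselJ0 t)
      linarith
    linarith
  · nlinarith

theorem integrableOn_one_sub_besselJ0_rpow_div_sq {s : ℝ} (hs : 2 ≤ s) :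
    IntegrableOn (fun t => (1 - |besselJ0 t| ^ s) / t ^ 2) (Set.Ioi 0) := by
  refine integrableOn_div_sq (h := fun t => 1 - |besselJ0 t| ^ s) ?_
    (fun t _ => (one_sub_abs_besselJ0_rpow_bounds hs t).1)
    (fun t _ => (one_sub_abs_besselJ0_rpow_bounds hs t).2)
  have := continuous_besselJ0.measurable
  fun_prop

/-- The passage from the exponent `2` to `s`, with `M = 107/250` and `G = exp (-t² / 4)`. Up to `46/25`
one has `|J₀| ≤ G` and `M ≤ G`, so that `G ^ s - |J₀| ^ s ≥ M ^ (s - 2) (G² - J₀²)`. From there on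
`|J₀| ≤ M`, so that `|J₀| ^ s ≤ M ^ (s - 2) J₀²`, and `G ^ s` is dropped. -/
theorem exp_sub_besselJ0_rpow_ge {s t : ℝ} (hs : 2 ≤ s) (ht : 0 < t) :
    (107 / 250) ^ (s - 2) * (Real.exp (-t ^ 2 / 2) - besselJ0 t ^ 2 -
      (Set.Ioi (46 / 25 : ℝ)).indicator (fun t => Real.exp (-t ^ 2 / 2)) t) ≤
      Real.exp (-(s / 4) * t ^ 2) - |besselJ0 t| ^ s := by
  have hG : ∀ r : ℝ, Real.exp (-t ^ 2 / 4) ^ r = Real.exp (-(r / 4) * t ^ 2) := by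
    intro r
    rw [← Real.exp_mul]
    congr 1
    ring
  have hG2 : Real.exp (-t ^ 2 / 2) = Real.exp (-t ^ 2 / 4) ^ 2 := by
    rw [← Real.exp_nat_mul]
    congr 1
    push_cast
    ring
  rw [← hG s, hG2, ← sq_abs (besselJ0 t)]
  have hsplit : ∀ y : ℝ, 0 ≤ y → y ^ s = y ^ (s - 2) * y ^ 2 := by
    intro y hy
    rw [← Real.rpow_natCast, ← Real.rpow_add_of_nonneg hy (by linarith) (by norm_num)]
    congr 1
    push_cast
    ring
  set G := Real.exp (-t ^ 2 / 4) with hGdef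
  set F := |besselJ0 t| with hF
  have hG0 : 0 < G := Real.exp_pos _
  have hF0 : 0 ≤ F := abs_nonneg _
  rw [hsplit G hG0.le, hsplit F hF0]
  rcases le_or_gt t (46 / 25) with h | h
  · rw [Set.indicator_of_notMem (by simpa using h), sub_zero]
    have hFG : F ≤ G := abs_besselJ0_le_exp (by nlinarith)
    have hMG : 107 / 250 ≤ G := by
      refine exp_neg_bounds.1.trans (Real.exp_le_exp.2 ?_)
      nlinarith
    have h1 : F ^ (s - 2) ≤ G ^ (s - 2) := Real.rpow_le_rpow hF0 hFG (by linarith)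
    have h2 : (107 / 250) ^ (s - 2) ≤ G ^ (s - 2) :=
      Real.rpow_le_rpow (by norm_num) hMG (by linarith)
    have h3 : F ^ 2 ≤ G ^ 2 := pow_le_pow_left₀ hF0 hFG 2
    nlinarith [mul_le_mul_of_nonneg_right h2 (sub_nonneg.2 h3),
      mul_le_mul_of_nonneg_right h1 (sq_nonneg F)]
  · rw [Set.indicator_of_mem (by exact h), hG2]
    have hFM : F ≤ 107 / 250 := abs_besselJ0_le_of_ge h.le
    have h1 : F ^ (s - 2) ≤ (107 / 250) ^ (s - 2) := Real.rpow_le_rpow hF0 hFM (by linarith)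
    have h2 : 0 ≤ G ^ (s - 2) * G ^ 2 := by positivity
    nlinarith [mul_le_mul_of_nonneg_right h1 (sq_nonneg F)]

/-- The Bessel integral with exponent `s ≥ 2` is at least its Gaussian limit. -/
theorem sqrt_le_integral_one_sub_besselJ0_rpow {s : ℝ} (hs : 2 ≤ s) :
    √(Real.pi * s) / 2 ≤ ∫ t in Set.Ioi (0 : ℝ), (1 - |besselJ0 t| ^ s) / t ^ 2 := by
  have hI1 := integrableOn_one_sub_besselJ0_rpow_div_sq hs
  have hI2 := integrableOn_one_sub_exp_div_sq (a := s / 4) (by linarith)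
  have hI3 : IntegrableOn (fun t => (1 - besselJ0 t ^ 2) / t ^ 2) (Set.Ioi 0) := by
    simpa using integrableOn_one_sub_besselJ0_rpow_div_sq (le_refl (2 : ℝ))
  have hI4 := integrableOn_one_sub_exp_div_sq (a := 1 / 2) (by norm_num)
  have hsub : Set.Ioi (46 / 25 : ℝ) ⊆ Set.Ioi 0 := Set.Ioi_subset_Ioi (by norm_num)
  have hI5 : IntegrableOn (fun t : ℝ => Real.exp (-t ^ 2 / 2) / t ^ 2) (Set.Ioi (46 / 25)) := by
    refine Integrable.mono' (g := fun t : ℝ => 1 * Real.exp (-(1 / 2) * t ^ 2))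
      ((integrable_exp_neg_mul_sq (by norm_num)).const_mul 1).integrableOn
      (Measurable.aestronglyMeasurable (by fun_prop)) ?_
    refine (ae_restrict_iff' measurableSet_Ioi).2 (Filter.Eventually.of_forall fun t ht => ?_)
    have ht' : (46 / 25 : ℝ) < t := ht
    rw [Real.norm_of_nonneg (by positivity), one_mul, show -(1 / 2) * t ^ 2 = -t ^ 2 / 2 by ring]
    exact div_le_self (Real.exp_pos _).le (by nlinarith)
  have hI6 : IntegrableOn ((Set.Ioi (46 / 25 : ℝ)).indicator
      fun t : ℝ => Real.exp (-t ^ 2 / 2) / t ^ 2) (Set.Ioi 0) :=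
    ((integrable_indicator_iff measurableSet_Ioi).2 hI5).integrableOn
  have hmono : ∫ t in Set.Ioi (0 : ℝ), (107 / 250) ^ (s - 2) *
      ((1 - besselJ0 t ^ 2) / t ^ 2 - (1 - Real.exp (-(1 / 2) * t ^ 2)) / t ^ 2 -
        (Set.Ioi (46 / 25 : ℝ)).indicator (fun t : ℝ => Real.exp (-t ^ 2 / 2) / t ^ 2) t) ≤
      ∫ t in Set.Ioi (0 : ℝ), ((1 - |besselJ0 t| ^ s) / t ^ 2 -
        (1 - Real.exp (-(s / 4) * t ^ 2)) / t ^ 2) := by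
    refine setIntegral_mono_on (((hI3.sub hI4).sub hI6).const_mul _) (hI1.sub hI2)
      measurableSet_Ioi fun t ht => ?_
    have ht' : 0 < t := ht
    have h := exp_sub_besselJ0_rpow_ge hs ht'
    have hind : (Set.Ioi (46 / 25 : ℝ)).indicator (fun t : ℝ => Real.exp (-t ^ 2 / 2) / t ^ 2) t =
        (Set.Ioi (46 / 25 : ℝ)).indicator (fun t : ℝ => Real.exp (-t ^ 2 / 2)) t / t ^ 2 := by
      by_cases hm : t ∈ Set.Ioi (46 / 25 : ℝ) <;> simp [hm]
    rw [hind, ← sub_div, ← sub_div, ← sub_div, ← mul_div_assoc]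
    refine div_le_div_of_nonneg_right ?_ (sq_nonneg t)
    rw [show -(1 / 2) * t ^ 2 = -t ^ 2 / 2 by ring]
    calc _ = _ := by ring
      _ ≤ _ := h
      _ = _ := by ring
  have hI34 : IntegrableOn (fun t : ℝ => (1 - besselJ0 t ^ 2) / t ^ 2 -
      (1 - Real.exp (-(1 / 2) * t ^ 2)) / t ^ 2) (Set.Ioi 0) := hI3.sub hI4
  rw [integral_const_mul, integral_sub hI34 hI6, integral_sub hI3 hI4,
    integral_sub hI1 hI2, integral_one_sub_exp_div_sq (by norm_num),
    integral_one_sub_exp_div_sq (by linarith), integral_one_sub_besselJ0_sq_div_sq,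
    setIntegral_indicator measurableSet_Ioi, Set.inter_eq_self_of_subset_right hsub] at hmono
  have hpos : 0 ≤ (107 / 250 : ℝ) ^ (s - 2) * (4 / Real.pi - √(Real.pi * (1 / 2)) -
      ∫ t in Set.Ioi (46 / 25 : ℝ), Real.exp (-t ^ 2 / 2) / t ^ 2) :=
    mul_nonneg (Real.rpow_nonneg (by norm_num) _) (by linarith [exp_tail_le_slack])
  have hsq : √(Real.pi * (s / 4)) = √(Real.pi * s) / 2 := by
    rw [show Real.pi * (s / 4) = Real.pi * s / 2 ^ 2 by ring, Real.sqrt_div' _ (by norm_num),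
      Real.sqrt_sq (by norm_num)]
  rw [hsq] at hmono
  linarith

/-! ### The sharp Khinchine inequality for sums of independent rotations -/

theorem abs_one_sub_prod_le_sum {ι : Type*} (S : Finset ι) {x : ι → ℝ}
    (hx : ∀ j, |x j| ≤ 1) : |1 - ∏ j ∈ S, x j| ≤ ∑ j ∈ S, |1 - x j| := by
  classical
  induction S using Finset.induction_on with
  | empty => simp
  | insert i S hi ih =>
    rw [Finset.prod_insert hi, Finset.sum_insert hi]
    have h : 1 - x i * ∏ j ∈ S, x j = (1 - x i) + x i * (1 - ∏ j ∈ S, x j) := by ring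
    rw [h]
    refine (abs_add_le _ _).trans (add_le_add le_rfl ?_)
    rw [abs_mul]
    exact (mul_le_of_le_one_left (abs_nonneg _) (hx i)).trans ih

theorem measurable_besselJ0_mul (r : ℝ) : Measurable fun t => besselJ0 (r * t) :=
  continuous_besselJ0.measurable.comp (measurable_const_mul r)

theorem abs_prod_besselJ0_le_one (b : ℕ → ℂ) (S : Finset ℕ) (t : ℝ) :
    |∏ j ∈ S, besselJ0 (‖b j‖ * t)| ≤ 1 := by
  rw [Finset.abs_prod]
  exact Finset.prod_le_one (fun _ _ => abs_nonneg _) fun _ _ => abs_besselJ0_le_one _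

theorem abs_one_sub_prod_besselJ0_le (b : ℕ → ℂ) (S : Finset ℕ) (t : ℝ) :
    |1 - ∏ j ∈ S, besselJ0 (‖b j‖ * t)| ≤ (∑ j ∈ S, ‖b j‖ ^ 2 / 4) * t ^ 2 := by
  refine (abs_one_sub_prod_le_sum S fun j => abs_besselJ0_le_one (‖b j‖ * t)).trans ?_
  rw [Finset.sum_mul]
  refine Finset.sum_le_sum fun j _ => ((one_sub_besselJ0_bounds _).2).trans (le_of_eq ?_)
  ring

theorem integrableOn_one_sub_prod_besselJ0_div_sq (b : ℕ → ℂ) (S : Finset ℕ) :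
    IntegrableOn (fun t => (1 - ∏ j ∈ S, besselJ0 (‖b j‖ * t)) / t ^ 2) (Set.Ioi 0) := by
  refine integrableOn_div_sq (h := fun t => 1 - ∏ j ∈ S, besselJ0 (‖b j‖ * t)) (A := 1 + 1)
    ((Finset.measurable_fun_prod _ fun j _ => measurable_besselJ0_mul _).const_sub 1)
    (fun t _ => ?_) (fun t _ => abs_one_sub_prod_besselJ0_le b S t)
  refine (abs_sub _ _).trans (add_le_add (le_of_eq abs_one) (abs_prod_besselJ0_le_one b S t))

theorem integrableOn_one_sub_abs_prod_pow_div_sq (b : ℕ → ℂ) (S : Finset ℕ) (k : ℕ) :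
    IntegrableOn (fun t => (1 - |∏ j ∈ S, besselJ0 (‖b j‖ * t)| ^ k) / t ^ 2) (Set.Ioi 0) := by
  have h1 : ∀ t, |∏ j ∈ S, besselJ0 (‖b j‖ * t)| ^ k ≤ 1 := fun t =>
    pow_le_one₀ (abs_nonneg _) (abs_prod_besselJ0_le_one b S t)
  have h0 : ∀ t, 0 ≤ |∏ j ∈ S, besselJ0 (‖b j‖ * t)| ^ k := fun t => by positivity
  refine integrableOn_div_sq (h := fun t => 1 - |∏ j ∈ S, besselJ0 (‖b j‖ * t)| ^ k) (A := 1)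
    (B := k * ∑ j ∈ S, ‖b j‖ ^ 2 / 4) ?_ (fun t _ => ?_) fun t _ => ?_
  · have := Finset.measurable_fun_prod S fun j _ => measurable_besselJ0_mul ‖b j‖
    fun_prop
  · rw [abs_of_nonneg (by linarith [h1 t])]
    linarith [h0 t]
  · have h2 := abs_one_sub_prod_le_sum (Finset.range k)
      (x := fun _ => |∏ j ∈ S, besselJ0 (‖b j‖ * t)|)
      (fun _ => by rw [abs_abs]; exact abs_prod_besselJ0_le_one b S t)
    rw [Finset.prod_const, Finset.sum_const, Finset.card_range, nsmul_eq_mul] at h2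
    rw [mul_assoc]
    refine h2.trans (mul_le_mul_of_nonneg_left ?_ (by positivity))
    refine le_trans ?_ (abs_one_sub_prod_besselJ0_le b S t)
    have := abs_abs_sub_abs_le (1 : ℝ) (∏ j ∈ S, besselJ0 (‖b j‖ * t))
    rwa [abs_one] at this

/-- By the inequality of arithmetic and geometric means with the weights `‖b_j‖² / N`, where `N` is
the sum of the `‖b_j‖²`, a product of Bessel functions is controlled by powers of single ones. -/
theorem sqrt_le_integral_one_sub_abs_prod_pow {b : ℕ → ℂ} {S : Finset ℕ}
    (hb : ∀ j ∈ S, b j ≠ 0) {k : ℕ} (hS : ∀ j ∈ S, 2 * ‖b j‖ ^ 2 ≤ k * ∑ j ∈ S, ‖b j‖ ^ 2) :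
    √(Real.pi * (k * ∑ j ∈ S, ‖b j‖ ^ 2)) / 2 ≤
      ∫ t in Set.Ioi (0 : ℝ), (1 - |∏ j ∈ S, besselJ0 (‖b j‖ * t)| ^ k) / t ^ 2 := by
  rcases S.eq_empty_or_nonempty with rfl | hne
  · simp
  set N := ∑ j ∈ S, ‖b j‖ ^ 2 with hN
  have hbp : ∀ j ∈ S, 0 < ‖b j‖ := fun j hj => norm_pos_iff.2 (hb j hj)
  have hN0 : 0 < N := Finset.sum_pos (fun j hj => pow_pos (hbp j hj) 2) hne
  set s : ℕ → ℝ := fun j => k * N / ‖b j‖ ^ 2 with hs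
  have hs2 : ∀ j ∈ S, 2 ≤ s j := fun j hj => by
    rw [hs]
    simp only
    rw [le_div_iff₀ (pow_pos (hbp j hj) 2)]
    exact hS j hj
  have hw : ∑ j ∈ S, ‖b j‖ ^ 2 / N = 1 := by rw [← Finset.sum_div, div_self hN0.ne']
  have hterm : ∀ j ∈ S, IntegrableOn
      (fun t => (1 - |besselJ0 (‖b j‖ * t)| ^ s j) / t ^ 2) (Set.Ioi 0) := by
    intro j hj
    refine integrableOn_div_sq (h := fun t => 1 - |besselJ0 (‖b j‖ * t)| ^ s j) (A := 1)
      (B := s j / 4 * ‖b j‖ ^ 2) ?_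
      (fun t _ => (one_sub_abs_besselJ0_rpow_bounds (hs2 j hj) _).1) (fun t _ => ?_)
    · have := measurable_besselJ0_mul ‖b j‖
      fun_prop
    · refine ((one_sub_abs_besselJ0_rpow_bounds (hs2 j hj) _).2).trans (le_of_eq ?_)
      ring
  have hamgm : ∀ t, |∏ j ∈ S, besselJ0 (‖b j‖ * t)| ^ k ≤
      ∑ j ∈ S, ‖b j‖ ^ 2 / N * |besselJ0 (‖b j‖ * t)| ^ s j := by
    intro t
    refine le_trans (le_of_eq ?_) (Real.geom_mean_le_arith_mean_weighted S
      (fun j => ‖b j‖ ^ 2 / N) (fun j => |besselJ0 (‖b j‖ * t)| ^ s j) (fun j _ => by positivity)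
      hw fun j _ => by positivity)
    rw [Finset.abs_prod, ← Finset.prod_pow]
    refine Finset.prod_congr rfl fun j hj => ?_
    rw [← Real.rpow_mul (abs_nonneg _), ← Real.rpow_natCast]
    congr 1
    rw [hs]
    have := (hbp j hj).ne'
    field_simp
  calc √(Real.pi * (k * N)) / 2
      = ∑ j ∈ S, ‖b j‖ ^ 2 / N * (‖b j‖ * (√(Real.pi * s j) / 2)) := by
        rw [← one_mul (√(Real.pi * (k * N)) / 2), ← hw, Finset.sum_mul]
        refine Finset.sum_congr rfl fun j hj => ?_
        congr 1
        have h := (hbp j hj)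
        rw [hs, show Real.pi * (k * N / ‖b j‖ ^ 2) = Real.pi * (k * N) / ‖b j‖ ^ 2 by ring,
          Real.sqrt_div' _ (by positivity), Real.sqrt_sq h.le]
        field_simp
    _ ≤ ∑ j ∈ S, ‖b j‖ ^ 2 / N *
          ∫ t in Set.Ioi (0 : ℝ), (1 - |besselJ0 (‖b j‖ * t)| ^ s j) / t ^ 2 := by
        refine Finset.sum_le_sum fun j hj => mul_le_mul_of_nonneg_left ?_ (by positivity)
        rw [integral_comp_mul_div_sq (fun t => 1 - |besselJ0 t| ^ s j) (hbp j hj)]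
        exact mul_le_mul_of_nonneg_left (sqrt_le_integral_one_sub_besselJ0_rpow (hs2 j hj))
          (norm_nonneg _)
    _ = ∫ t in Set.Ioi (0 : ℝ), ∑ j ∈ S, ‖b j‖ ^ 2 / N *
          ((1 - |besselJ0 (‖b j‖ * t)| ^ s j) / t ^ 2) := by
        rw [integral_finsetSum _ fun j hj => (hterm j hj).const_mul _]
        simp_rw [integral_const_mul]
    _ ≤ _ := by
        refine setIntegral_mono_on (integrable_finsetSum _ fun j hj => (hterm j hj).const_mul _)
          (integrableOn_one_sub_abs_prod_pow_div_sq b S k) measurableSet_Ioi fun t _ => ?_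
        simp_rw [← mul_div_assoc]
        rw [← Finset.sum_div]
        refine div_le_div_of_nonneg_right ?_ (sq_nonneg t)
        simp_rw [mul_sub, mul_one]
        rw [Finset.sum_sub_distrib, hw]
        exact sub_le_sub_left (hamgm t) 1

/-- The case in which no coefficient dominates. -/
theorem khinchine_of_forall_le {b : ℕ → ℂ} {S : Finset ℕ} (hb : ∀ j ∈ S, b j ≠ 0)
    (hS : ∀ j ∈ S, 2 * ‖b j‖ ^ 2 ≤ ∑ j ∈ S, ‖b j‖ ^ 2) :
    √(Real.pi * ∑ j ∈ S, ‖b j‖ ^ 2) / 2 ≤ ∫ ω, ‖steinhausSum b S ω‖ ∂polytorusMeasure := by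
  have h := sqrt_le_integral_one_sub_abs_prod_pow hb (k := 1) (by simpa using hS)
  simp only [Nat.cast_one, one_mul, pow_one] at h
  rw [integral_norm_steinhausSum]
  have hI := integrableOn_one_sub_abs_prod_pow_div_sq b S 1
  simp only [pow_one] at hI
  refine h.trans (setIntegral_mono_on hI
    (integrableOn_one_sub_prod_besselJ0_div_sq b S) measurableSet_Ioi fun t _ => ?_)
  gcongr
  exact le_abs_self _

/-- The inequality `x y ≤ (x² + y²) / 2` decouples one variable from the others. -/
theorem integral_norm_steinhausSum_insert_ge_of_decouple {b : ℕ → ℂ} {S : Finset ℕ} {i : ℕ}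
    (hi : i ∉ S) (hbi : b i ≠ 0) (hb : ∀ j ∈ S, b j ≠ 0) :
    2 / Real.pi * ‖b i‖ + √(Real.pi * (2 * ∑ j ∈ S, ‖b j‖ ^ 2)) / 4 ≤
      ∫ ω, ‖steinhausSum b (insert i S) ω‖ ∂polytorusMeasure := by
  have h1 := sqrt_le_integral_one_sub_abs_prod_pow hb (k := 2) fun j hj => by
    push_cast
    refine mul_le_mul_of_nonneg_left ?_ (by norm_num)
    exact Finset.single_le_sum (f := fun j => ‖b j‖ ^ 2) (fun j _ => by positivity) hj
  have h2 := integral_comp_mul_div_sq (fun t => 1 - besselJ0 t ^ 2) (norm_pos_iff.2 hbi)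
  rw [integral_one_sub_besselJ0_sq_div_sq] at h2
  have hI1 : IntegrableOn (fun t => (1 - besselJ0 (‖b i‖ * t) ^ 2) / t ^ 2) (Set.Ioi 0) := by
    simpa using integrableOn_one_sub_abs_prod_pow_div_sq b {i} 2
  have hI2 := integrableOn_one_sub_abs_prod_pow_div_sq b S 2
  have h3 : ∫ t in Set.Ioi (0 : ℝ), (1 / 2 * ((1 - besselJ0 (‖b i‖ * t) ^ 2) / t ^ 2) +
      1 / 2 * ((1 - |∏ j ∈ S, besselJ0 (‖b j‖ * t)| ^ 2) / t ^ 2)) ≤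
      ∫ ω, ‖steinhausSum b (insert i S) ω‖ ∂polytorusMeasure := by
    rw [integral_norm_steinhausSum]
    refine setIntegral_mono_on ((hI1.const_mul _).add (hI2.const_mul _))
      (integrableOn_one_sub_prod_besselJ0_div_sq b (insert i S)) measurableSet_Ioi fun t _ => ?_
    rw [Finset.prod_insert hi, ← mul_div_assoc, ← mul_div_assoc, ← add_div, sq_abs]
    refine div_le_div_of_nonneg_right ?_ (sq_nonneg t)
    nlinarith [sq_nonneg (besselJ0 (‖b i‖ * t) - ∏ j ∈ S, besselJ0 (‖b j‖ * t))]
  rw [integral_add (hI1.const_mul _) (hI2.const_mul _), integral_const_mul, integral_const_mul,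
    h2] at h3
  push_cast at h1
  refine le_trans ?_ h3
  have : 2 / Real.pi * ‖b i‖ = 1 / 2 * (‖b i‖ * (4 / Real.pi)) := by ring
  rw [this]
  linarith

theorem sqrt_pi_div_two_le_of_decouple {u : ℝ} (h1 : 1 / 2 ≤ u) (h2 : u ≤ 29 / 50) :
    √Real.pi / 2 ≤ 2 / Real.pi * √u + √(Real.pi * (2 * (1 - u))) / 4 := by
  have hp1 := Real.pi_lt_d4
  have hp2 := Real.pi_gt_d4
  have e1 : √Real.pi ≤ 17725 / 10000 := Real.sqrt_le_iff.2 ⟨by norm_num, by linarith⟩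
  have e2 : 6366 / 10000 ≤ 2 / Real.pi := by
    rw [le_div_iff₀ Real.pi_pos]
    linarith
  -- chords of the concave functions `√u` and `√(1 - u)` on `[1/2, 29/50]`
  have e3 : 7071 / 10000 + 68 / 100 * (u - 1 / 2) ≤ √u := by
    apply Real.le_sqrt_of_sq_le
    nlinarith [mul_nonneg (sub_nonneg.2 h1) (sub_nonneg.2 h2)]
  have e4 : 7071 / 10000 - 74 / 100 * (u - 1 / 2) ≤ √(1 - u) := by
    apply Real.le_sqrt_of_sq_le
    nlinarith [mul_nonneg (sub_nonneg.2 h1) (sub_nonneg.2 h2)]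
  have e5 : 25065 / 10000 ≤ √(Real.pi * 2) := by
    apply Real.le_sqrt_of_sq_le
    linarith
  rw [← mul_assoc, Real.sqrt_mul (by positivity) (1 - u)]
  have e6 : 6366 / 10000 * (7071 / 10000 + 68 / 100 * (u - 1 / 2)) ≤ 2 / Real.pi * √u :=
    mul_le_mul e2 e3 (by linarith) (by positivity)
  have e7 : 25065 / 10000 * (7071 / 10000 - 74 / 100 * (u - 1 / 2)) ≤
      √(Real.pi * 2) * √(1 - u) :=
    mul_le_mul e5 e4 (by linarith) (by positivity)
  linarith

theorem sqrt_pi_div_two_le_of_expansion {m : ℝ} (h1 : 0 ≤ m) (h2 : m ≤ 21 / 29) :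
    √(Real.pi * (1 + m)) / 2 ≤ 1 + m / 4 - m ^ 2 / 128 := by
  have hp := Real.pi_lt_d4
  have hm : m ^ 2 ≤ 1 := by nlinarith
  rw [div_le_iff₀ (by norm_num)]
  refine Real.sqrt_le_iff.2 ⟨by linarith, ?_⟩
  have h3 : Real.pi * (1 + m) ≤ 3.1416 * (1 + m) :=
    mul_le_mul_of_nonneg_right hp.le (by linarith)
  refine h3.trans ?_
  have h4 : (1 + 31 / 128 * m) ^ 2 ≤ (1 + m / 4 - m ^ 2 / 128) ^ 2 := by
    apply pow_le_pow_left₀ (by linarith)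
    nlinarith
  nlinarith

theorem khinchine_steinhaus_of_ne_zero {b : ℕ → ℂ} {S : Finset ℕ} (hb : ∀ j ∈ S, b j ≠ 0) :
    √(Real.pi * ∑ j ∈ S, ‖b j‖ ^ 2) / 2 ≤ ∫ ω, ‖steinhausSum b S ω‖ ∂polytorusMeasure := by
  by_cases hall : ∀ j ∈ S, 2 * ‖b j‖ ^ 2 ≤ ∑ j ∈ S, ‖b j‖ ^ 2
  · exact khinchine_of_forall_le hb hall
  push Not at hall
  obtain ⟨i, hiS, hi⟩ := hall
  obtain ⟨S', hiS', rfl⟩ : ∃ S', i ∉ S' ∧ insert i S' = S :=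
    ⟨S.erase i, Finset.notMem_erase i S, Finset.insert_erase hiS⟩
  have hbi := hb i (Finset.mem_insert_self _ _)
  have hr : 0 < ‖b i‖ := norm_pos_iff.2 hbi
  rw [Finset.sum_insert hiS'] at hi ⊢
  have hge := integral_norm_steinhausSum_insert_ge b hiS' hbi
  have hge2 := integral_norm_steinhausSum_insert_ge_of_decouple hiS' hbi
    fun j hj => hb j (Finset.mem_insert_of_mem hj)
  have hN : 0 ≤ ∑ j ∈ S', ‖b j‖ ^ 2 := Finset.sum_nonneg fun j _ => by positivity
  set N := ∑ j ∈ S', ‖b j‖ ^ 2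
  set r := ‖b i‖
  have hT : 0 < r ^ 2 + N := by positivity
  rcases le_total (r ^ 2) (29 / 50 * (r ^ 2 + N)) with h | h
  · refine le_trans ?_ hge2
    have h3 := sqrt_pi_div_two_le_of_decouple (u := r ^ 2 / (r ^ 2 + N))
      (by rw [le_div_iff₀ hT]; linarith) (by rw [div_le_iff₀ hT]; exact h)
    have h4 := mul_le_mul_of_nonneg_left h3 (Real.sqrt_nonneg (r ^ 2 + N))
    have e1 : √(r ^ 2 + N) * √(r ^ 2 / (r ^ 2 + N)) = r := by
      rw [← Real.sqrt_mul hT.le, mul_div_cancel₀ _ hT.ne', Real.sqrt_sq hr.le]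
    have e2 : √(r ^ 2 + N) * √(Real.pi * (2 * (1 - r ^ 2 / (r ^ 2 + N)))) =
        √(Real.pi * (2 * N)) := by
      rw [← Real.sqrt_mul hT.le]
      congr 1
      field_simp
      ring
    have e3 : √(Real.pi * (r ^ 2 + N)) = √(r ^ 2 + N) * √Real.pi := by
      rw [mul_comm, Real.sqrt_mul hT.le]
    rw [e3]
    calc √(r ^ 2 + N) * √Real.pi / 2 = √(r ^ 2 + N) * (√Real.pi / 2) := by ring
      _ ≤ _ := h4
      _ = 2 / Real.pi * (√(r ^ 2 + N) * √(r ^ 2 / (r ^ 2 + N))) +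
          √(r ^ 2 + N) * √(Real.pi * (2 * (1 - r ^ 2 / (r ^ 2 + N)))) / 4 := by ring
      _ = _ := by rw [e1, e2]
  · refine le_trans ?_ hge
    have h3 := sqrt_pi_div_two_le_of_expansion (m := N / r ^ 2) (by positivity)
      (by rw [div_le_iff₀ (by positivity)]; linarith)
    have e1 : √(Real.pi * (r ^ 2 + N)) = r * √(Real.pi * (1 + N / r ^ 2)) := by
      rw [show Real.pi * (r ^ 2 + N) = r ^ 2 * (Real.pi * (1 + N / r ^ 2)) by field_simp,
        Real.sqrt_mul (by positivity), Real.sqrt_sq hr.le]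
    rw [e1, mul_div_assoc]
    exact mul_le_mul_of_nonneg_left h3 hr.le

/-- **Sharp Khinchine inequality** between the `L¹` and `L²` norms of a linear combination of
independent variables uniformly distributed on the unit circle. -/
theorem khinchine_steinhaus (b : ℕ → ℂ) (S : Finset ℕ) :
    √(Real.pi * ∑ j ∈ S, ‖b j‖ ^ 2) / 2 ≤ ∫ ω, ‖steinhausSum b S ω‖ ∂polytorusMeasure := by
  classical
  have h := khinchine_steinhaus_of_ne_zero (b := b) (S := S.filter fun j => b j ≠ 0)
    fun j hj => (Finset.mem_filter.1 hj).2
  have e1 : ∑ j ∈ S with b j ≠ 0, ‖b j‖ ^ 2 = ∑ j ∈ S, ‖b j‖ ^ 2 := by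
    refine Finset.sum_filter_of_ne fun j _ hj h0 => hj ?_
    simp [h0]
  have e2 : steinhausSum b (S.filter fun j => b j ≠ 0) = steinhausSum b S := by
    funext ω
    refine Finset.sum_filter_of_ne fun j _ hj h0 => hj ?_
    simp [h0]
  rwa [e1, e2] at h

/-! ### Singular values of an operator of rank two -/

section RankTwo

variable {E F : Type*} [NormedAddCommGroup E] [InnerProductSpace ℂ E]
  [NormedAddCommGroup F] [InnerProductSpace ℂ F]

open InnerProductSpace in
/-- The operator `x ↦ ⟪e, x⟫ v' + ⟪v, x⟫ e'`. -/
noncomputable def swapOperator (e v : E) (e' v' : F) : E →L[ℂ] F :=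
  rankOne ℂ v' e + rankOne ℂ e' v

theorem swapOperator_apply (e v : E) (e' v' : F) (x : E) :
    swapOperator e v e' v' x = inner ℂ e x • v' + inner ℂ v x • e' := rfl

theorem isCompactOperator_swapOperator (e v : E) (e' v' : F) :
    IsCompactOperator (swapOperator e v e' v') := by
  have h : ∀ (x : F) (y : E), IsCompactOperator fun z : E => inner ℂ y z • x := by
    intro x y
    exact (isCompactOperator_of_locallyCompactSpace_rng
      (ContinuousLinearMap.toSpanSingleton ℂ x)).comp_clm (innerSL ℂ y)
  exact (h v' e).add (h e' v)

variable [CompleteSpace E] [CompleteSpace F] {e v : E} {e' v' : F} {ρ : ℝ}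

theorem adjoint_swapOperator_comp_apply (he' : ‖e'‖ = 1) (hev' : inner ℂ e' v' = 0)
    (hv' : ‖v'‖ = ρ) (x : E) :
    (ContinuousLinearMap.adjoint (swapOperator e v e' v') ∘L swapOperator e v e' v') x =
      ((ρ : ℂ) ^ 2 * inner ℂ e x) • e + inner ℂ v x • v := by
  have hve' : inner ℂ v' e' = 0 := inner_eq_zero_symm.1 hev'
  have hadj : ∀ y, ContinuousLinearMap.adjoint (swapOperator e v e' v') y =
      inner ℂ v' y • e + inner ℂ e' y • v := by
    intro y
    rw [swapOperator, map_add, InnerProductSpace.adjoint_rankOne,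
      InnerProductSpace.adjoint_rankOne]
    rfl
  rw [ContinuousLinearMap.comp_apply, hadj, swapOperator_apply]
  simp only [inner_add_right, inner_smul_right, hev', hve', inner_self_eq_norm_sq_to_K, he', hv']
  simp [mul_comm]

theorem singularValueMultiplicity_swapOperator_self (he : ‖e‖ = 1) (he' : ‖e'‖ = 1)
    (hev : inner ℂ e v = 0) (hev' : inner ℂ e' v' = 0) (hv : ‖v‖ = ρ) (hv' : ‖v'‖ = ρ)
    (hρ : 0 < ρ) : singularValueMultiplicity (swapOperator e v e' v') ρ = 2 := by
  have hve : inner ℂ v e = 0 := inner_eq_zero_symm.1 hev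
  have hspan : Module.End.eigenspace ((ContinuousLinearMap.adjoint (swapOperator e v e' v') ∘L
      swapOperator e v e' v' : E →L[ℂ] E) : E →ₗ[ℂ] E) ((ρ : ℂ) ^ 2) =
      Submodule.span ℂ (Set.range ![e, v]) := by
    have hρ2 : (ρ : ℂ) ^ 2 ≠ 0 := pow_ne_zero 2 (Complex.ofReal_ne_zero.2 hρ.ne')
    apply le_antisymm
    · intro x hx
      rw [Module.End.mem_eigenspace_iff, ContinuousLinearMap.coe_coe,
        adjoint_swapOperator_comp_apply he' hev' hv'] at hx
      rw [← Submodule.smul_mem_iff _ hρ2, ← hx]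
      refine Submodule.add_mem _ (Submodule.smul_mem _ _ (Submodule.subset_span ⟨0, rfl⟩))
        (Submodule.smul_mem _ _ (Submodule.subset_span ⟨1, rfl⟩))
    · rw [Submodule.span_le]
      rintro _ ⟨i, rfl⟩
      rw [SetLike.mem_coe, Module.End.mem_eigenspace_iff, ContinuousLinearMap.coe_coe,
        adjoint_swapOperator_comp_apply he' hev' hv']
      fin_cases i
      · simp [hve, inner_self_eq_norm_sq_to_K, he]
      · simp [hev, inner_self_eq_norm_sq_to_K, hv]
  have hli : LinearIndependent ℂ ![e, v] := by
    have he0 : e ≠ 0 := norm_ne_zero_iff.1 (by rw [he]; norm_num)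
    have hv0 : v ≠ 0 := norm_ne_zero_iff.1 (by rw [hv]; exact hρ.ne')
    refine linearIndependent_of_ne_zero_of_inner_eq_zero (𝕜 := ℂ) ?_ ?_
    · intro i
      fin_cases i
      · exact he0
      · exact hv0
    · intro i j hij
      fin_cases i <;> fin_cases j
      · exact absurd rfl hij
      · exact hev
      · exact hve
      · exact absurd rfl hij
  rw [singularValueMultiplicity, hspan, finrank_span_eq_card hli, Fintype.card_fin]

theorem singularValueMultiplicity_swapOperator_of_ne (he : ‖e‖ = 1) (he' : ‖e'‖ = 1)
    (hev : inner ℂ e v = 0) (hev' : inner ℂ e' v' = 0) (hv : ‖v‖ = ρ) (hv' : ‖v'‖ = ρ)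
    {s : ℝ} (hs : 0 < s) (hsρ : s ≠ ρ) :
    singularValueMultiplicity (swapOperator e v e' v') s = 0 := by
  have hve : inner ℂ v e = 0 := inner_eq_zero_symm.1 hev
  have hρ : 0 ≤ ρ := hv ▸ norm_nonneg v
  have hs2 : (s : ℂ) ^ 2 ≠ 0 := pow_ne_zero 2 (Complex.ofReal_ne_zero.2 hs.ne')
  have hne : (s : ℂ) ^ 2 - (ρ : ℂ) ^ 2 ≠ 0 := by
    rw [← Complex.ofReal_pow, ← Complex.ofReal_pow, ← Complex.ofReal_sub, Complex.ofReal_ne_zero,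
      sub_ne_zero]
    exact fun h => hsρ ((pow_left_inj₀ hs.le hρ two_ne_zero).1 h)
  have hbot : Module.End.eigenspace ((ContinuousLinearMap.adjoint (swapOperator e v e' v') ∘L
      swapOperator e v e' v' : E →L[ℂ] E) : E →ₗ[ℂ] E) ((s : ℂ) ^ 2) = ⊥ := by
    rw [eq_bot_iff]
    intro x hx
    rw [Module.End.mem_eigenspace_iff, ContinuousLinearMap.coe_coe,
      adjoint_swapOperator_comp_apply he' hev' hv'] at hx
    have h1 : inner ℂ e x = 0 := by
      have h := congrArg (inner ℂ e) hx
      simp only [inner_add_right, inner_smul_right, hev, inner_self_eq_norm_sq_to_K, he] at h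
      simp only [Complex.coe_algebraMap, Complex.ofReal_one, one_pow, mul_one, mul_zero,
        add_zero] at h
      refine (mul_eq_zero.1 (?_ : ((s : ℂ) ^ 2 - (ρ : ℂ) ^ 2) * inner ℂ e x = 0)).resolve_left hne
      linear_combination -h
    have h2 : inner ℂ v x = 0 := by
      have h := congrArg (inner ℂ v) hx
      simp only [inner_add_right, inner_smul_right, hve, inner_self_eq_norm_sq_to_K, hv] at h
      simp only [Complex.coe_algebraMap, mul_zero, zero_add] at h
      refine (mul_eq_zero.1 (?_ : ((s : ℂ) ^ 2 - (ρ : ℂ) ^ 2) * inner ℂ v x = 0)).resolve_left hne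
      linear_combination -h
    rw [h1, h2, mul_zero, zero_smul, zero_smul, add_zero] at hx
    exact (smul_eq_zero.1 hx.symm).resolve_left hs2
  rw [singularValueMultiplicity, hbot, finrank_bot]

/-- If `e ⊥ v` and `e' ⊥ v'`, where `e`, `e'` are unit vectors and `‖v‖ = ‖v'‖ = ρ`, then the
singular values of the operator are `ρ`, `ρ`. -/
theorem schatten_swapOperator (he : ‖e‖ = 1) (he' : ‖e'‖ = 1)
    (hev : inner ℂ e v = 0) (hev' : inner ℂ e' v' = 0) (hv : ‖v‖ = ρ) (hv' : ‖v'‖ = ρ)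
    {p : ℝ} (hp : 0 < p) : MemSchatten p (swapOperator e v e' v') ∧
      schattenNorm p (swapOperator e v e' v') = 2 ^ (1 / p) * ρ := by
  have hρ : 0 ≤ ρ := hv ▸ norm_nonneg v
  have hsum : HasSum (fun s : Set.Ioi (0 : ℝ) =>
      (singularValueMultiplicity (swapOperator e v e' v') s : ℝ) * (s : ℝ) ^ p) (2 * ρ ^ p) := by
    rcases hρ.eq_or_lt with h0 | h0
    · convert hasSum_zero with s
      · rw [singularValueMultiplicity_swapOperator_of_ne he he' hev hev' hv hv' s.2
          (h0 ▸ ne_of_gt s.2)]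
        simp
      · rw [← h0, Real.zero_rpow hp.ne', mul_zero]
    · have h := hasSum_single (f := fun s : Set.Ioi (0 : ℝ) =>
        (singularValueMultiplicity (swapOperator e v e' v') s : ℝ) * (s : ℝ) ^ p) ⟨ρ, h0⟩ ?_
      · simpa [singularValueMultiplicity_swapOperator_self he he' hev hev' hv hv' h0] using h
      · intro s hs
        rw [singularValueMultiplicity_swapOperator_of_ne he he' hev hev' hv hv' s.2
          fun h => hs (Subtype.ext h)]
        simp
  refine ⟨⟨isCompactOperator_swapOperator e v e' v', hsum.summable⟩, ?_⟩
  rw [schattenNorm, hsum.tsum_eq, Real.mul_rpow (by norm_num) (by positivity),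
    ← Real.rpow_mul hρ, mul_one_div_cancel hp.ne', Real.rpow_one]

end RankTwo

/-! ### Fourier coefficients of polynomials -/

theorem polytorusMeasure_map_add (τ : Polytorus) :
    polytorusMeasure.map (fun ω => ω + τ) = polytorusMeasure := by
  have h := Measure.infinitePi_map_pi
    (fun _ : ℕ => (AddCircle.haarAddCircle : Measure UnitAddCircle))
    (f := fun (i : ℕ) (θ : UnitAddCircle) => θ + τ i) (fun i => measurable_add_const _)
  refine h.trans ?_
  congr 1
  funext i
  exact map_add_right_eq_self _ _

theorem integral_comp_add (G : Polytorus → ℂ) (τ : Polytorus) :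
    ∫ ω, G (ω + τ) ∂polytorusMeasure = ∫ ω, G ω ∂polytorusMeasure := by
  conv_rhs => rw [← polytorusMeasure_map_add τ]
  exact (integral_map_equiv (MeasurableEquiv.addRight τ) G).symm

theorem coordFun_apply (j : ℕ) (ω : Polytorus) : coordFun j ω = (AddCircle.toCircle (ω j) : ℂ) :=
  fourier_one

theorem polyFun_monomial_apply (α : ℕ →₀ ℕ) (c : ℂ) (ω : Polytorus) :
    polyFun (MvPolynomial.monomial α c) ω =
      c * α.prod fun i k => (AddCircle.toCircle (ω i) : ℂ) ^ k := by
  rw [polyFun, MvPolynomial.aeval_monomial, Finsupp.prod, Finsupp.prod, ContinuousMap.mul_apply,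
    ContinuousMap.prod_apply]
  simp only [ContinuousMap.pow_apply, coordFun_apply]
  rfl

theorem polyFun_monomial_add_single (α : ℕ →₀ ℕ) (c : ℂ) (ω : Polytorus) (i : ℕ)
    (θ : UnitAddCircle) : polyFun (MvPolynomial.monomial α c) (ω + Pi.single i θ) =
      (AddCircle.toCircle θ : ℂ) ^ α i * polyFun (MvPolynomial.monomial α c) ω := by
  have h : (α.prod fun j k => (AddCircle.toCircle ((Pi.single i θ : Polytorus) j) : ℂ) ^ k) =
      (AddCircle.toCircle θ : ℂ) ^ α i := by
    rw [Finsupp.prod, Finset.prod_eq_single i]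
    · rw [Pi.single_eq_same]
    · intro j _ hj
      rw [Pi.single_eq_of_ne hj, AddCircle.toCircle_zero, Circle.coe_one, one_pow]
    · intro hi
      rw [Finsupp.notMem_support_iff.1 hi, pow_zero]
  rw [polyFun_monomial_apply, polyFun_monomial_apply, ← h, mul_left_comm, ← Finsupp.prod_mul]
  congr 1
  refine Finset.prod_congr rfl fun j _ => ?_
  beta_reduce
  rw [Pi.add_apply, AddCircle.toCircle_add, Circle.coe_mul, mul_pow, mul_comm]

/-- Distinct monomials are orthogonal: the rotation of one variable multiplies the inner product by
a nontrivial character. -/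
theorem integral_monomial_mul_star_of_ne {α β : ℕ →₀ ℕ} (h : α ≠ β) (c d : ℂ) :
    ∫ ω, polyFun (MvPolynomial.monomial α c) ω * star (polyFun (MvPolynomial.monomial β d) ω)
      ∂polytorusMeasure = 0 := by
  obtain ⟨i, hi⟩ := Finsupp.ne_iff.1 h
  have hi' : ((α i : ℝ) - β i) ≠ 0 := sub_ne_zero.2 (by exact_mod_cast hi)
  obtain ⟨θ, hθ⟩ := exists_toCircle_eq (Circle.exp (Real.pi / (α i - β i)))
  have hchar : (AddCircle.toCircle θ : ℂ) ^ α i * star ((AddCircle.toCircle θ : ℂ) ^ β i) = -1 := by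
    rw [hθ, Circle.coe_exp, star_pow, Complex.star_def, ← Complex.exp_conj, ← Complex.exp_nat_mul,
      ← Complex.exp_nat_mul, ← Complex.exp_add, ← Complex.exp_pi_mul_I]
    congr 1
    rw [map_mul, Complex.conj_ofReal, Complex.conj_I]
    push_cast
    have : ((α i : ℂ) - β i) ≠ 0 := by exact_mod_cast hi'
    field_simp
    ring
  have hI := integral_comp_add (fun ω => polyFun (MvPolynomial.monomial α c) ω *
    star (polyFun (MvPolynomial.monomial β d) ω)) (Pi.single i θ)
  simp only [polyFun_monomial_add_single, star_mul'] at hI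
  have h2 : ∀ ω, (AddCircle.toCircle θ : ℂ) ^ α i * polyFun (MvPolynomial.monomial α c) ω *
      (star ((AddCircle.toCircle θ : ℂ) ^ β i) * star (polyFun (MvPolynomial.monomial β d) ω)) =
      (-1) * (polyFun (MvPolynomial.monomial α c) ω *
        star (polyFun (MvPolynomial.monomial β d) ω)) := by
    intro ω
    rw [← hchar]
    ring
  simp only [h2] at hI
  rw [integral_const_mul] at hI
  linear_combination (-1 / 2 : ℂ) * hI

theorem integral_monomial_mul_star_self (α : ℕ →₀ ℕ) (c : ℂ) :
    ∫ ω, polyFun (MvPolynomial.monomial α c) ω * star (polyFun (MvPolynomial.monomial α 1) ω)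
      ∂polytorusMeasure = c := by
  have h : ∀ ω, polyFun (MvPolynomial.monomial α c) ω *
      star (polyFun (MvPolynomial.monomial α 1) ω) = c := by
    intro ω
    rw [polyFun_monomial_apply, polyFun_monomial_apply, one_mul, mul_assoc, Complex.star_def,
      Complex.mul_conj, Complex.normSq_eq_norm_sq, Finsupp.prod, norm_prod]
    simp only [norm_pow, Circle.norm_coe, one_pow, Finset.prod_const_one, Complex.ofReal_one,
      mul_one]
  simp only [h]
  simp

theorem integral_poly_mul_star_monomial (P : MvPolynomial ℕ ℂ) (β : ℕ →₀ ℕ) :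
    ∫ ω, polyFun P ω * star (polyFun (MvPolynomial.monomial β 1) ω) ∂polytorusMeasure =
      P.coeff β := by
  induction P using MvPolynomial.induction_on' with
  | monomial α c =>
    rw [MvPolynomial.coeff_monomial]
    split_ifs with h
    · rw [h, integral_monomial_mul_star_self]
    · exact integral_monomial_mul_star_of_ne h c 1
  | add P Q hP hQ =>
    have hadd : polyFun (P + Q) = polyFun P + polyFun Q := map_add _ P Q
    simp only [hadd, ContinuousMap.add_apply, add_mul]
    rw [integral_add (integrable_torus (by fun_prop)) (integrable_torus (by fun_prop)), hP, hQ,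
      MvPolynomial.coeff_add]

theorem linearPoly_eq_sum_monomial {d : ℕ} (a : Fin d → ℂ) :
    linearPoly a = ∑ j : Fin d, a j • MvPolynomial.monomial (Finsupp.single (j : ℕ) 1) 1 := by
  refine Finset.sum_congr rfl fun j _ => ?_
  rw [MvPolynomial.smul_eq_C_mul]
  rfl

theorem polyFun_one : polyFun 1 = 1 := map_one _

theorem polyFun_mul (P Q : MvPolynomial ℕ ℂ) : polyFun (P * Q) = polyFun P * polyFun Q :=
  map_mul _ P Q

theorem integral_poly (P : MvPolynomial ℕ ℂ) :
    ∫ ω, polyFun P ω ∂polytorusMeasure = P.coeff 0 := by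
  rw [← integral_poly_mul_star_monomial]
  refine integral_congr_ae (Filter.Eventually.of_forall fun ω => ?_)
  simp [polyFun_one]

theorem integral_poly_mul_star_linearPoly (P : MvPolynomial ℕ ℂ) {d : ℕ} (a : Fin d → ℂ) :
    ∫ ω, polyFun P ω * star (polyFun (linearPoly a) ω) ∂polytorusMeasure =
      ∑ j : Fin d, star (a j) * P.coeff (Finsupp.single (j : ℕ) 1) := by
  simp_rw [← integral_poly_mul_star_monomial, ← integral_const_mul]
  rw [← integral_finsetSum _ fun j _ => (integrable_torus (by fun_prop))]
  refine integral_congr_ae (Filter.Eventually.of_forall fun ω => ?_)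
  have h : polyFun (linearPoly a) =
      ∑ j : Fin d, a j • polyFun (MvPolynomial.monomial (Finsupp.single (j : ℕ) 1) 1) := by
    rw [linearPoly_eq_sum_monomial]
    simp only [polyFun, map_sum, map_smul]
  simp only [h, ContinuousMap.sum_apply, ContinuousMap.smul_apply, smul_eq_mul, star_sum,
    star_mul', Finset.mul_sum]
  exact Finset.sum_congr rfl fun j _ => by ring

/-- The linear coefficients of a product: pairing with a linear symbol is a derivation at the
origin. -/
theorem integral_mul_mul_star_linearPoly (P Q : MvPolynomial ℕ ℂ) {d : ℕ} (a : Fin d → ℂ) :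
    ∫ ω, polyFun (P * Q) ω * star (polyFun (linearPoly a) ω) ∂polytorusMeasure =
      P.coeff 0 * (∫ ω, polyFun Q ω * star (polyFun (linearPoly a) ω) ∂polytorusMeasure) +
      (∫ ω, polyFun P ω * star (polyFun (linearPoly a) ω) ∂polytorusMeasure) * Q.coeff 0 := by
  simp only [integral_poly_mul_star_linearPoly, Finset.mul_sum, Finset.sum_mul,
    ← Finset.sum_add_distrib]
  refine Finset.sum_congr rfl fun j _ => ?_
  rw [MvPolynomial.coeff_mul, Finsupp.antidiagonal_single, Finset.sum_map]
  simp [Finset.Nat.antidiagonal_succ]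
  ring

/-! ### The Hankel operator of a linear symbol -/

/-- The conjugate of an analytic polynomial as an element of the anti-analytic Hardy space. -/
noncomputable def polyAntiHardy (P : MvPolynomial ℕ ℂ) : antiHardySpace :=
  ⟨conjPolyL2 P, Submodule.le_topologicalClosure _ (Submodule.subset_span ⟨P, rfl⟩)⟩

theorem inner_polyL2 (P Q : MvPolynomial ℕ ℂ) : inner ℂ (polyL2 P) (polyL2 Q) =
    ∫ ω, polyFun Q ω * star (polyFun P ω) ∂polytorusMeasure :=
  ContinuousMap.inner_toLp _ _ _

theorem inner_conjPolyL2 (P Q : MvPolynomial ℕ ℂ) : inner ℂ (conjPolyL2 P) (conjPolyL2 Q) =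
    ∫ ω, polyFun P ω * star (polyFun Q ω) ∂polytorusMeasure := by
  refine (ContinuousMap.inner_toLp _ _ _).trans ?_
  simp [mul_comm]

theorem conjMulPoly_polyL2 (A P : MvPolynomial ℕ ℂ) : conjMulPoly (polyL2 A) P =
    ContinuousMap.toLp 2 polytorusMeasure ℂ (star (polyFun A) * polyFun P) := by
  apply Lp.ext
  filter_upwards [(memLp_conj_mul_poly (polyL2 A) P).coeFn_toLp,
    ContinuousMap.coeFn_toLp (p := 2) (𝕜 := ℂ) polytorusMeasure (polyFun A),
    ContinuousMap.coeFn_toLp (p := 2) (𝕜 := ℂ) polytorusMeasure (star (polyFun A) * polyFun P)]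
    with ω h1 h2 h3
  rw [conjMulPoly, h1, h3, polyL2, h2]
  rfl

theorem inner_conjMulPoly_conjPolyL2 (A P Q : MvPolynomial ℕ ℂ) :
    inner ℂ (conjPolyL2 Q) (conjMulPoly (polyL2 A) P) =
      ∫ ω, polyFun (P * Q) ω * star (polyFun A ω) ∂polytorusMeasure := by
  rw [conjMulPoly_polyL2]
  refine (ContinuousMap.inner_toLp _ _ _).trans ?_
  refine integral_congr_ae (Filter.Eventually.of_forall fun ω => ?_)
  simp [polyFun_mul]
  ring

/-- The Hankel operator of a linear symbol `φ` is `h ↦ ⟪1, h⟫ φ̄ + ⟪φ, h⟫ 1`. -/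
theorem isHankelOperator_linearPoly {d : ℕ} (a : Fin d → ℂ) :
    IsHankelOperator (polyL2 (linearPoly a)) (swapOperator (polyHardy 1)
      (polyHardy (linearPoly a)) (polyAntiHardy 1) (polyAntiHardy (linearPoly a))) := by
  intro P
  apply Subtype.ext
  rw [Submodule.coe_orthogonalProjectionOnto_apply]
  symm
  refine Submodule.eq_starProjection_of_mem_of_inner_eq_zero (Subtype.property _) ?_
  set u := conjMulPoly (polyL2 (linearPoly a)) P -
    (swapOperator (polyHardy 1) (polyHardy (linearPoly a)) (polyAntiHardy 1)
      (polyAntiHardy (linearPoly a)) (polyHardy P) : L2Polytorus) with hu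
  suffices h : antiHardySpace ≤ (Submodule.span ℂ {u})ᗮ from
    fun w hw => Submodule.mem_orthogonal_singleton_iff_inner_right.1 (h hw)
  refine Submodule.topologicalClosure_minimal _ ?_ (Submodule.isClosed_orthogonal _)
  rw [Submodule.span_le]
  rintro _ ⟨Q, rfl⟩
  rw [SetLike.mem_coe, Submodule.mem_orthogonal_singleton_iff_inner_left]
  have h1 : (swapOperator (polyHardy 1) (polyHardy (linearPoly a)) (polyAntiHardy 1)
      (polyAntiHardy (linearPoly a)) (polyHardy P) : L2Polytorus) =
      (inner ℂ (polyL2 1) (polyL2 P) : ℂ) • conjPolyL2 (linearPoly a) +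
        (inner ℂ (polyL2 (linearPoly a)) (polyL2 P) : ℂ) • conjPolyL2 1 := rfl
  rw [hu, inner_sub_right, inner_conjMulPoly_conjPolyL2, h1, inner_add_right, inner_smul_right,
    inner_smul_right, inner_conjPolyL2, inner_conjPolyL2, inner_polyL2, inner_polyL2,
    integral_mul_mul_star_linearPoly]
  simp only [polyFun_one, ContinuousMap.one_apply, star_one, mul_one, integral_poly]
  ring

theorem norm_eq_of_inner_self {E : Type*} [NormedAddCommGroup E] [InnerProductSpace ℂ E]
    {x : E} {r : ℝ} (hr : 0 ≤ r) (h : inner ℂ x x = ((r ^ 2 : ℝ) : ℂ)) : ‖x‖ = r := by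
  rw [inner_self_eq_norm_sq_to_K] at h
  have h2 : ‖x‖ ^ 2 = r ^ 2 := by
    simp only [Complex.coe_algebraMap] at h
    exact_mod_cast h
  exact (pow_left_inj₀ (norm_nonneg _) hr two_ne_zero).1 h2

theorem coeff_zero_linearPoly {d : ℕ} (a : Fin d → ℂ) : (linearPoly a).coeff 0 = 0 := by
  rw [linearPoly, MvPolynomial.coeff_sum]
  exact Finset.sum_eq_zero fun j _ => by simp [MvPolynomial.coeff_C_mul]

theorem coeff_single_linearPoly {d : ℕ} (a : Fin d → ℂ) (j : Fin d) :
    (linearPoly a).coeff (Finsupp.single (j : ℕ) 1) = a j := by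
  rw [linearPoly, MvPolynomial.coeff_sum, Finset.sum_eq_single j]
  · simp [MvPolynomial.coeff_C_mul]
  · intro i _ hij
    rw [MvPolynomial.coeff_C_mul, MvPolynomial.coeff_X, if_neg, mul_zero]
    intro h
    exact hij (Fin.ext ((Finsupp.single_left_inj one_ne_zero).1 h))
  · simp

theorem integral_linearPoly_mul_star {d : ℕ} (a b : Fin d → ℂ) :
    ∫ ω, polyFun (linearPoly b) ω * star (polyFun (linearPoly a) ω) ∂polytorusMeasure =
      ∑ j : Fin d, star (a j) * b j := by
  simp only [integral_poly_mul_star_linearPoly, coeff_single_linearPoly]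

theorem hankel_linearPoly {p : ℝ} (hp : 0 < p) {d : ℕ} (a : Fin d → ℂ) :
    HankelMemSchatten p (polyL2 (linearPoly a)) ∧
      hankelSchattenNorm p (polyL2 (linearPoly a)) = 2 ^ (1 / p) * √(∑ j, ‖a j‖ ^ 2) := by
  have hT := isHankelOperator_linearPoly a
  have h11 : ∫ ω, polyFun 1 ω * star (polyFun 1 ω) ∂polytorusMeasure = 1 := by
    simp [polyFun_one]
  have haa : ∫ ω, polyFun (linearPoly a) ω * star (polyFun (linearPoly a) ω) ∂polytorusMeasure =
      ((√(∑ j, ‖a j‖ ^ 2) ^ 2 : ℝ) : ℂ) := by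
    rw [integral_linearPoly_mul_star, Real.sq_sqrt (Finset.sum_nonneg fun j _ => sq_nonneg _)]
    push_cast
    refine Finset.sum_congr rfl fun j _ => ?_
    rw [Complex.star_def, mul_comm, Complex.mul_conj, Complex.normSq_eq_norm_sq]
    push_cast
    rfl
  have ha1 : ∫ ω, polyFun (linearPoly a) ω * star (polyFun 1 ω) ∂polytorusMeasure = 0 := by
    simp [polyFun_one, integral_poly, coeff_zero_linearPoly]
  have h1a : ∫ ω, polyFun 1 ω * star (polyFun (linearPoly a) ω) ∂polytorusMeasure = 0 := by
    rw [integral_poly_mul_star_linearPoly]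
    refine Finset.sum_eq_zero fun j _ => ?_
    rw [MvPolynomial.coeff_one, if_neg, mul_zero]
    exact fun h => one_ne_zero (Finsupp.single_eq_zero.1 h.symm)
  have h := schatten_swapOperator (e := polyHardy 1) (v := polyHardy (linearPoly a))
    (e' := polyAntiHardy 1) (v' := polyAntiHardy (linearPoly a)) (ρ := √(∑ j, ‖a j‖ ^ 2))
    (norm_eq_of_inner_self zero_le_one
      ((inner_polyL2 1 1).trans (h11.trans (by norm_num))))
    (norm_eq_of_inner_self zero_le_one
      ((inner_conjPolyL2 1 1).trans (h11.trans (by norm_num))))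
    ((inner_polyL2 _ _).trans ha1) ((inner_conjPolyL2 _ _).trans h1a)
    (norm_eq_of_inner_self (Real.sqrt_nonneg _) ((inner_polyL2 _ _).trans haa))
    (norm_eq_of_inner_self (Real.sqrt_nonneg _) ((inner_conjPolyL2 _ _).trans haa)) hp
  rw [HankelMemSchatten, hankelSchattenNorm, hT.eq_hankelOperator]
  exact ⟨⟨⟨_, hT⟩, h.1⟩, h.2⟩

/-- The role of the critical exponent: `2 ^ (1 / p₀) = 2 / √π`. -/
theorem two_div_sqrt_pi_le_rpow {p : ℝ} (hp : 0 < p) (hp₀ : p ≤ criticalExponent) :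
    2 / √Real.pi ≤ 2 ^ (1 / p) := by
  have hlog2 : 0 < Real.log 2 := Real.log_pos (by norm_num)
  have hlog4 : Real.log 4 = 2 * Real.log 2 := by
    rw [show (4 : ℝ) = 2 ^ 2 by norm_num, Real.log_pow]
    norm_num
  have h1 : 1 - Real.log Real.pi / Real.log 4 ≤ 1 / p := by
    rw [one_div]
    rw [criticalExponent] at hp₀
    have := inv_anti₀ hp hp₀
    rwa [inv_inv] at this
  refine le_trans (le_of_eq ?_) (Real.rpow_le_rpow_of_exponent_le (by norm_num) h1)
  rw [Real.rpow_sub (by norm_num), Real.rpow_one, Real.sqrt_eq_rpow]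
  congr 1
  rw [Real.rpow_def_of_pos Real.pi_pos, Real.rpow_def_of_pos (by norm_num : (0 : ℝ) < 2), hlog4]
  congr 1
  field_simp

theorem mainTheorem2 (p : ℝ) (hp : 0 < p) (hp₀ : p ≤ criticalExponent)
    (d : ℕ) (a b : Fin d → ℂ) :
    HankelMemSchatten p (polyL2 (linearPoly a)) ∧
      ‖∫ z, polyFun (linearPoly b) z * star (polyFun (linearPoly a) z) ∂polytorusMeasure‖ ≤
        hankelSchattenNorm p (polyL2 (linearPoly a)) *
          ∫ z, ‖polyFun (linearPoly b) z‖ ∂polytorusMeasure := by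
  obtain ⟨hmem, hnorm⟩ := hankel_linearPoly hp a
  refine ⟨hmem, ?_⟩
  rw [hnorm, integral_linearPoly_mul_star]
  set b' : ℕ → ℂ := fun n => if h : n < d then b ⟨n, h⟩ else 0 with hb'
  have hb'j : ∀ j : Fin d, b' j = b j := fun j => by simp [hb']
  have hpoly : ∀ ω, polyFun (linearPoly b) ω = steinhausSum b' (Finset.range d) ω := by
    intro ω
    rw [steinhausSum, ← Fin.sum_univ_eq_sum_range (fun n =>
      b' n * (AddCircle.toCircle (ω n) : ℂ)) d, linearPoly_eq_sum_monomial]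
    simp only [polyFun, map_sum, map_smul, ContinuousMap.sum_apply, ContinuousMap.smul_apply]
    refine Finset.sum_congr rfl fun j _ => ?_
    have h := polyFun_monomial_apply (Finsupp.single (j : ℕ) 1) 1 ω
    rw [polyFun] at h
    rw [h, hb'j]
    simp
  simp only [hpoly]
  have hK := khinchine_steinhaus b' (Finset.range d)
  rw [← Fin.sum_univ_eq_sum_range (fun n => ‖b' n‖ ^ 2) d] at hK
  simp only [hb'j] at hK
  have hCS : ‖∑ j, star (a j) * b j‖ ≤ √(∑ j, ‖a j‖ ^ 2) * √(∑ j, ‖b j‖ ^ 2) := by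
    refine (norm_sum_le _ _).trans ?_
    simp only [norm_mul, norm_star]
    exact Real.sum_mul_le_sqrt_mul_sqrt _ _ _
  refine hCS.trans ?_
  rw [mul_comm ((2 : ℝ) ^ (1 / p)), mul_assoc]
  refine mul_le_mul_of_nonneg_left ?_ (Real.sqrt_nonneg _)
  have hpi : 0 < √Real.pi := Real.sqrt_pos.2 Real.pi_pos
  calc √(∑ j, ‖b j‖ ^ 2) = 2 / √Real.pi * (√(Real.pi * ∑ j, ‖b j‖ ^ 2) / 2) := by
        rw [Real.sqrt_mul Real.pi_pos.le]
        field_simp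
    _ ≤ _ := mul_le_mul (two_div_sqrt_pi_le_rpow hp hp₀) hK (by positivity) (by positivity)
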